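/- **Lemma 3.3 (well-posedness).** Let $\Omega\subset\mathbb R^2$ be a bounded polygonal domain with boundary $\Gamma$, let $\mathcal T_h$ be a conforming triangulation of $\Omega$ (a finite set of nondegenerate closed triangles, any two of which are disjoint or meet in a common vertex or a common edge, whose union is $\overline\Omega$, and such that $\Gamma$ is a union of edges), let $\mathcal E_h$ be the set of its edges, and fix for every $e\in\mathcal E_h$ a unit vector $\boldsymbol n_e$ normal to $e$. Let $k\ge 0$ be an integer and let $f\in L^2(\Omega)$. Write $\mathbb P_m(D)$ for the polynomials of degree at most $m$ on $D$, and let $$S_h=\{w\in H_0^1(\Omega): w|_K\in\mathbb P_{k+2}(K)\ \ \forall K\in\mathcal T_h\},$$ $$V_h^0=\{v=\{v_0,v_n\boldsymbol n_e\}: v_0\in S_h,\ v_n\in L^2(\mathcal E_h),\ v_n|_e\in\mathbb P_{k+1}(e)\ \ \forall e\in\mathcal E_h,\ \ v_n|_e=0\ \text{ for } e\subset\Gamma\}.$$ For $v=\{v_0,v_n\boldsymbol n_e\}\in V_h^0$ let the weak Laplacian $\Delta_{w}v$ be defined piecewise on every $K\in\mathcal T_h$ as the unique polynomial $(\Delta_w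 v)|_K\in\mathbb P_{k+3}(K)$ such that $$\int_K (\Delta_w v)\,\varphi\,dx=-\int_K\nabla v_0\cdot\nabla\varphi\,dx+\int_{\partial K}v_n\,(\boldsymbol n_e\cdot\boldsymbol n)\,\varphi\,ds\qquad\forall\varphi\in\mathbb P_{k+3}(K),$$ where $\boldsymbol n$ is the outward unit normal on $\partial K$. Then there is exactly one $u_h\in V_h^0$ such that $$\sum_{K\in\mathcal T_h}\int_K \Delta_w u_h\,\Delta_w v\,dx=\int_\Omega f\,v_0\,dx\qquad\forall v=\{v_0,v_n\boldsymbol n_e\}\in V_h^0 .$$ -/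

import Mathlib

open MeasureTheory Filter Topology
open scoped ContDiff

noncomputable section

namespace SFC0WG

/-- The Euclidean plane. -/
abbrev Plane : Type := EuclideanSpace ℝ (Fin 2)

/-- The closed simplex (triangle, edge or point) spanned by a finite set of vertices. -/
abbrev hull (s : Finset Plane) : Set Plane := convexHull ℝ (s : Set Plane)

/-! ### Polynomials -/

/-- `Poly m`: real polynomials in two variables of total degree at most `m`. Their restrictions to
a triangle `K` or to an edge `e` form the spaces `P_m(K)` and `P_m(e)`. -/
abbrev Poly (m : ℕ) : Submodule ℝ (MvPolynomial (Fin 2) ℝ) :=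
  MvPolynomial.restrictTotalDegree (Fin 2) ℝ m

/-- The polynomial function on the plane defined by `p`. -/
def polyFun (p : MvPolynomial (Fin 2) ℝ) (x : Plane) : ℝ :=
  MvPolynomial.eval (fun i => x i) p

/-- The inner product `∇ p · ∇ q` of the gradients of two polynomials. -/
def gradDot (p q : MvPolynomial (Fin 2) ℝ) (x : Plane) : ℝ :=
  ∑ i : Fin 2, polyFun (MvPolynomial.pderiv i p) x * polyFun (MvPolynomial.pderiv i q) x

/-! ### Triangulations -/

/-- A (finite, conforming) triangulation of an open set `Ω` of the plane: a finite simplicial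
complex, all of whose simplices are faces of (nondegenerate) triangles, which covers exactly the
closure of `Ω`, and such that the boundary of `Ω` is a union of edges. An open set which has a
triangulation is bounded, and its boundary is a finite union of segments. -/
structure Triangulation (Ω : Set Plane) extends Geometry.SimplicialComplex ℝ Plane where
  finite_faces : faces.Finite
  pure : ∀ s ∈ faces, ∃ t ∈ faces, s ⊆ t ∧ t.card = 3
  cover : ⋃ s ∈ faces, hull s = closure Ω
  boundary : ∃ B ⊆ {e ∈ faces | e.card = 2}, frontier Ω = ⋃ e ∈ B, hull e

variable {Ω : Set Plane}

/-- The triangles of the mesh, given by their three vertices. -/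
def Triangulation.triangles (T : Triangulation Ω) : Finset (Finset Plane) :=
  T.finite_faces.toFinset.filter fun s => s.card = 3

/-- The set of all edges of the mesh (interior or on the boundary), given by their endpoints. -/
def Triangulation.edges (T : Triangulation Ω) : Finset (Finset Plane) :=
  T.finite_faces.toFinset.filter fun s => s.card = 2

/-- The three edges of a triangle. -/
def edgesOf (K : Finset Plane) : Finset (Finset Plane) := K.powersetCard 2

/-- The union of all edges of the mesh. -/
def Triangulation.skeleton (T : Triangulation Ω) : Set Plane := ⋃ e ∈ T.edges, hull e

open Classical in
/-- The unit normal vector on the edge `e` of the triangle `K` pointing out of `K`: the normalized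
component orthogonal to `e` of a vector from the vertex opposite to `e` to a point of `e`
(the double sum is twice the vector from the opposite vertex to the midpoint of `e`). -/
def outwardNormal (K e : Finset Plane) : Plane :=
  let w : Plane := (vectorSpan ℝ (e : Set Plane))ᗮ.starProjection (∑ x ∈ e, ∑ z ∈ K \ e, (x - z))
  ‖w‖⁻¹ • w

/-- `ν` chooses, for every edge `e` of the mesh, a unit vector `ν e` normal to `e`. -/
def IsNormalChoice (T : Triangulation Ω) (ν : Finset Plane → Plane) : Prop :=
  ∀ e ∈ T.edges, ‖ν e‖ = 1 ∧ ∀ x ∈ e, ∀ y ∈ e, inner ℝ (ν e) (y - x) = 0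

/-! ### Function spaces -/

/-- `L²(Ω)`. -/
abbrev L2 (Ω : Set Plane) : Type := Lp ℝ 2 (volume.restrict Ω)

/-- `L²` of the union of the edges, with respect to arc length (the one-dimensional Hausdorff
measure). -/
abbrev Triangulation.EdgeL2 (T : Triangulation Ω) : Type :=
  Lp ℝ 2 ((μH[1] : Measure Plane).restrict T.skeleton)

/-- `v ∈ H¹₀(Ω)`, the closure of `C_c^∞(Ω)` in `H¹(Ω)`: there are test functions `φ n` on `Ω` that
converge to `v` in `L²(Ω)` while their gradients converge in `L²(Ω)` to some vector field `g`
(the weak gradient of `v`). -/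
def IsH10 (v : L2 Ω) : Prop :=
  ∃ (g : Plane → Plane) (φ : ℕ → Plane → ℝ),
    MemLp g 2 (volume.restrict Ω) ∧
    (∀ n, ContDiff ℝ ∞ (φ n) ∧ HasCompactSupport (φ n) ∧ tsupport (φ n) ⊆ Ω) ∧
    Tendsto (fun n => eLpNorm (fun x => φ n x - v x) 2 (volume.restrict Ω)) atTop (𝓝 0) ∧
    Tendsto (fun n => eLpNorm (fun x => gradient (φ n) x - g x) 2 (volume.restrict Ω)) atTop (𝓝 0)

/-- The polynomial `p` represents the function `v` on the triangle `K`. -/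
def Represents (p : MvPolynomial (Fin 2) ℝ) (v : Plane → ℝ) (K : Finset Plane) : Prop :=
  v =ᵐ[volume.restrict (hull K)] polyFun p

/-- `S_h`: the functions of `H¹₀(Ω)` which are polynomials of degree at most `k + 2` on every
triangle. -/
def Sh (T : Triangulation Ω) (k : ℕ) : Set (L2 Ω) :=
  {v | IsH10 v ∧ ∀ K ∈ T.triangles, ∃ p ∈ Poly (k + 2), Represents p v K}

/-- The broken polynomial space `P_m(E_h)` on the set of edges. -/
def EdgePoly (T : Triangulation Ω) (m : ℕ) : Set T.EdgeL2 :=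
  {q | ∀ e ∈ T.edges, ∃ p ∈ Poly m, q =ᵐ[(μH[1] : Measure Plane).restrict (hull e)] polyFun p}

/-- The weak Galerkin space `V_h`. An element `{v₀, vₙ nₑ}` is the pair `(v₀, vₙ)`. -/
def Vh (T : Triangulation Ω) (k : ℕ) : Set (L2 Ω × T.EdgeL2) :=
  {v | v.1 ∈ Sh T k ∧ v.2 ∈ EdgePoly T (k + 1)}

/-- The subspace `V_h^0` of `V_h`: `vₙ` vanishes on the edges contained in the boundary. -/
def Vh0 (T : Triangulation Ω) (k : ℕ) : Set (L2 Ω × T.EdgeL2) :=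
  {v | v ∈ Vh T k ∧ ∀ e ∈ T.edges, hull e ⊆ frontier Ω →
    v.2 =ᵐ[(μH[1] : Measure Plane).restrict (hull e)] 0}

/-! ### The weak Laplacian and the scheme -/

/-- The polynomial which represents `v` on `K` (it is unique if it exists). -/
def localPoly (v : Plane → ℝ) (K : Finset Plane) : MvPolynomial (Fin 2) ℝ :=
  Classical.epsilon fun p => Represents p v K

/-- The right-hand side `-(∇v₀, ∇φ)_K + ⟨vₙ nₑ · n, φ⟩_{∂K}` in the definition of the weak
Laplacian. -/
def weakLaplacianRhs (T : Triangulation Ω) (ν : Finset Plane → Plane) (v : L2 Ω × T.EdgeL2)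
    (K : Finset Plane) (φ : MvPolynomial (Fin 2) ℝ) : ℝ :=
  -(∫ x in hull K, gradDot (localPoly v.1 K) φ x) +
    ∑ e ∈ edgesOf K, ∫ x in hull e,
      v.2 x * inner ℝ (ν e) (outwardNormal K e) * polyFun φ x ∂(μH[1] : Measure Plane)

/-- `d` is the weak Laplacian of degree `m` of `v` on the triangle `K`. -/
def IsWeakLaplacian (T : Triangulation Ω) (ν : Finset Plane → Plane) (m : ℕ)
    (v : L2 Ω × T.EdgeL2) (K : Finset Plane) (d : MvPolynomial (Fin 2) ℝ) : Prop :=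
  d ∈ Poly m ∧ ∀ φ ∈ Poly m,
    ∫ x in hull K, polyFun d x * polyFun φ x = weakLaplacianRhs T ν v K φ

/-- The weak Laplacian `Δ_{w,m} v` on the triangle `K` (see `existsUnique_weakLaplacian`). -/
def weakLaplacian (T : Triangulation Ω) (ν : Finset Plane → Plane) (m : ℕ)
    (v : L2 Ω × T.EdgeL2) (K : Finset Plane) : MvPolynomial (Fin 2) ℝ :=
  Classical.epsilon fun d => IsWeakLaplacian T ν m v K d

/-- The bilinear form `A_h(v, w) = (Δ_{w,k+3} v, Δ_{w,k+3} w)_{T_h}`. -/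
def Ah (T : Triangulation Ω) (ν : Finset Plane → Plane) (k : ℕ) (v w : L2 Ω × T.EdgeL2) : ℝ :=
  ∑ K ∈ T.triangles, ∫ x in hull K,
    polyFun (weakLaplacian T ν (k + 3) v K) x * polyFun (weakLaplacian T ν (k + 3) w K) x

/-- `u` solves the stabilizer-free `C⁰` weak Galerkin scheme with right-hand side `f`. -/
def IsSolution (T : Triangulation Ω) (ν : Finset Plane → Plane) (k : ℕ) (f : Plane → ℝ)
    (u : L2 Ω × T.EdgeL2) : Prop :=
  u ∈ Vh0 T k ∧ ∀ v ∈ Vh0 T k, Ah T ν k u v = ∫ x in Ω, f x * v.1 x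

/-! ### The outward normal, the local polynomials and the weak Laplacian are well defined -/

lemma continuous_polyFun (p : MvPolynomial (Fin 2) ℝ) : Continuous (polyFun p) := by
  unfold polyFun
  exact (MvPolynomial.continuous_eval p).comp (by fun_prop)

lemma Triangulation.mem_triangles {T : Triangulation Ω} {K : Finset Plane} :
    K ∈ T.triangles ↔ K ∈ T.faces ∧ K.card = 3 := by
  simp [Triangulation.triangles]

lemma Triangulation.mem_edges {T : Triangulation Ω} {K : Finset Plane} :
    K ∈ T.edges ↔ K ∈ T.faces ∧ K.card = 2 := by
  simp [Triangulation.edges]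

lemma Triangulation.edgesOf_subset {T : Triangulation Ω} {K : Finset Plane}
    (hK : K ∈ T.triangles) : edgesOf K ⊆ T.edges := by
  intro e he
  rw [edgesOf, Finset.mem_powersetCard] at he
  rw [T.mem_triangles] at hK
  rw [T.mem_edges]
  exact ⟨T.down_closed hK.1 he.1 (Finset.card_pos.1 (by omega)), he.2⟩

lemma isCompact_hull (s : Finset Plane) : IsCompact (hull s) :=
  s.finite_toSet.isCompact_convexHull ℝ

lemma Triangulation.interior_nonempty {T : Triangulation Ω} {K : Finset Plane}
    (hK : K ∈ T.triangles) : (interior (hull K)).Nonempty := by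
  rw [T.mem_triangles] at hK
  rw [interior_convexHull_nonempty_iff_affineSpan_eq_top]
  have h := T.indep hK.1
  have h2 := (h.affineSpan_eq_top_iff_card_eq_finrank_add_one).2 (by simp [hK.2])
  simpa using h2

/-- A polynomial is determined by its values on a nonempty open set. -/
lemma eq_of_eqOn_open {p q : MvPolynomial (Fin 2) ℝ} {U : Set Plane} (hU : IsOpen U)
    (hne : U.Nonempty) (h : Set.EqOn (polyFun p) (polyFun q) U) : p = q := by
  obtain ⟨a, ha⟩ := hne
  let V : Set (Fin 2 → ℝ) := (WithLp.toLp 2) ⁻¹' U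
  have hV : IsOpen V := hU.preimage (by fun_prop)
  have haV : a.ofLp ∈ V := by simpa [V] using ha
  obtain ⟨ε, hε, hb⟩ := Metric.isOpen_iff.1 hV _ haV
  refine MvPolynomial.funext_set (fun i => Metric.ball (a.ofLp i) ε) (fun i => ?_) (fun x hx => ?_)
  · rw [Real.ball_eq_Ioo]
    exact Set.Ioo_infinite (by linarith)
  · have hxV : x ∈ V := hb (by
      rw [ball_pi _ hε]
      exact hx)
    simpa [polyFun] using h hxV

lemma eq_of_ae_eq {p q : MvPolynomial (Fin 2) ℝ} {K : Finset Plane}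
    (hK : (interior (hull K)).Nonempty)
    (h : polyFun p =ᵐ[volume.restrict (hull K)] polyFun q) : p = q := by
  refine eq_of_eqOn_open isOpen_interior hK ?_
  refine Measure.eqOn_open_of_ae_eq (μ := volume) ?_ isOpen_interior
    (continuous_polyFun p).continuousOn (continuous_polyFun q).continuousOn
  exact ae_restrict_of_ae_restrict_of_subset interior_subset h

/-- The polynomial representing a function on a triangle is unique. -/
lemma localPoly_eq {T : Triangulation Ω} {K : Finset Plane} (hK : K ∈ T.triangles)
    {v : Plane → ℝ} {p : MvPolynomial (Fin 2) ℝ} (hp : Represents p v K) : localPoly v K = p := by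
  have h : Represents (localPoly v K) v K := Classical.epsilon_spec (p := fun p => Represents p v K) ⟨p, hp⟩
  exact eq_of_ae_eq (T.interior_nonempty hK) (h.symm.trans hp)

lemma integrableOn_polyFun_mul (p q : MvPolynomial (Fin 2) ℝ) (K : Finset Plane) :
    IntegrableOn (fun x => polyFun p x * polyFun q x) (hull K) :=
  ((continuous_polyFun p).mul (continuous_polyFun q)).continuousOn.integrableOn_compact
    (isCompact_hull K)

lemma polyFun_add (p q : MvPolynomial (Fin 2) ℝ) (x : Plane) :
    polyFun (p + q) x = polyFun p x + polyFun q x := by simp [polyFun]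

lemma polyFun_sub (p q : MvPolynomial (Fin 2) ℝ) (x : Plane) :
    polyFun (p - q) x = polyFun p x - polyFun q x := by simp [polyFun]

lemma polyFun_smul (c : ℝ) (p : MvPolynomial (Fin 2) ℝ) (x : Plane) :
    polyFun (c • p) x = c * polyFun p x := by simp [polyFun, MvPolynomial.smul_eval]

/-- The `L²(K)` inner product is definite on polynomials. -/
lemma eq_zero_of_integral_sq {p : MvPolynomial (Fin 2) ℝ} {K : Finset Plane}
    (hK : (interior (hull K)).Nonempty)
    (h : ∫ x in hull K, polyFun p x * polyFun p x = 0) : p = 0 := by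
  refine eq_of_ae_eq hK ?_
  have h1 := (integral_eq_zero_iff_of_nonneg (fun x => mul_self_nonneg _)
    (integrableOn_polyFun_mul p p K)).1 h
  filter_upwards [h1] with x hx
  simpa [polyFun] using hx

lemma hausdorff_hull_lt_top {e : Finset Plane} (he : e.card = 2) :
    (μH[1] : Measure Plane) (hull e) < ⊤ := by
  obtain ⟨a, b, -, rfl⟩ := Finset.card_eq_two.1 he
  have : hull {a, b} = segment ℝ a b := by simp [hull, convexHull_pair]
  rw [this, hausdorffMeasure_segment]
  exact edist_lt_top _ _

lemma integrableOn_edge {T : Triangulation Ω} {e : Finset Plane} (he : e ∈ T.edges)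
    (w : T.EdgeL2) (c : ℝ) (φ : MvPolynomial (Fin 2) ℝ) :
    IntegrableOn (fun x => w x * c * polyFun φ x) (hull e) (μH[1] : Measure Plane) := by
  have hfin : IsFiniteMeasure ((μH[1] : Measure Plane).restrict (hull e)) :=
    ⟨by simpa using hausdorff_hull_lt_top (T.mem_edges.1 he).2⟩
  have hsub : hull e ⊆ T.skeleton := Set.subset_biUnion_of_mem (u := fun e => hull e) he
  have h1 : MemLp w 2 ((μH[1] : Measure Plane).restrict (hull e)) :=
    (Lp.memLp w).mono_measure (Measure.restrict_mono hsub le_rfl)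
  have h2 : IntegrableOn (fun x => w x * c) (hull e) (μH[1] : Measure Plane) :=
    (h1.integrable (by norm_num)).mul_const c
  exact h2.mul_continuousOn (continuous_polyFun φ).continuousOn (isCompact_hull e)

lemma integrableOn_gradDot (p q : MvPolynomial (Fin 2) ℝ) (K : Finset Plane) :
    IntegrableOn (gradDot p q) (hull K) := by
  refine (Continuous.continuousOn ?_).integrableOn_compact (isCompact_hull K)
  unfold gradDot
  exact continuous_finsetSum _ fun i _ => (continuous_polyFun _).mul (continuous_polyFun _)

lemma weakLaplacianRhs_add {T : Triangulation Ω} {K : Finset Plane} (hK : K ∈ T.triangles)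
    (ν : Finset Plane → Plane) (v : L2 Ω × T.EdgeL2) (φ ψ : MvPolynomial (Fin 2) ℝ) :
    weakLaplacianRhs T ν v K (φ + ψ) = weakLaplacianRhs T ν v K φ + weakLaplacianRhs T ν v K ψ := by
  have h1 : ∀ x, gradDot (localPoly v.1 K) (φ + ψ) x =
      gradDot (localPoly v.1 K) φ x + gradDot (localPoly v.1 K) ψ x := fun x => by
    simp only [gradDot, map_add, polyFun_add, mul_add, Finset.sum_add_distrib]
  have h2 : ∀ e ∈ edgesOf K, ∫ x in hull e,
      v.2 x * inner ℝ (ν e) (outwardNormal K e) * polyFun (φ + ψ) x ∂(μH[1] : Measure Plane) =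
      (∫ x in hull e,
        v.2 x * inner ℝ (ν e) (outwardNormal K e) * polyFun φ x ∂(μH[1] : Measure Plane)) +
      ∫ x in hull e,
        v.2 x * inner ℝ (ν e) (outwardNormal K e) * polyFun ψ x ∂(μH[1] : Measure Plane) :=
    fun e he => by
      rw [← integral_add (integrableOn_edge (T.edgesOf_subset hK he) _ _ _)
        (integrableOn_edge (T.edgesOf_subset hK he) _ _ _)]
      simp only [polyFun_add, mul_add]
  simp only [weakLaplacianRhs, h1]
  rw [integral_add (integrableOn_gradDot _ _ _) (integrableOn_gradDot _ _ _),
    Finset.sum_congr rfl h2, Finset.sum_add_distrib]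
  ring

lemma weakLaplacianRhs_smul (T : Triangulation Ω) (K : Finset Plane)
    (ν : Finset Plane → Plane) (v : L2 Ω × T.EdgeL2) (c : ℝ) (φ : MvPolynomial (Fin 2) ℝ) :
    weakLaplacianRhs T ν v K (c • φ) = c * weakLaplacianRhs T ν v K φ := by
  have h1 : ∀ x, gradDot (localPoly v.1 K) (c • φ) x = c * gradDot (localPoly v.1 K) φ x :=
    fun x => by
      simp only [gradDot, Derivation.map_smul, polyFun_smul, Finset.mul_sum]
      exact Finset.sum_congr rfl fun i _ => by ring
  simp only [weakLaplacianRhs, h1, polyFun_smul, mul_left_comm _ c, integral_const_mul,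
    ← Finset.mul_sum]
  ring

/-- The weak Laplacian is well defined. -/
lemma existsUnique_weakLaplacian {T : Triangulation Ω} {K : Finset Plane} (hK : K ∈ T.triangles)
    (ν : Finset Plane → Plane) (m : ℕ) (v : L2 Ω × T.EdgeL2) :
    ∃! d, IsWeakLaplacian T ν m v K d := by
  have hint := T.interior_nonempty hK
  let B : Poly m →ₗ[ℝ] Module.Dual ℝ (Poly m) :=
    LinearMap.mk₂ ℝ (fun p q => ∫ x in hull K, polyFun p x * polyFun q x)
      (fun p p' q => by
        simp only [Submodule.coe_add, polyFun_add, add_mul]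
        exact integral_add (integrableOn_polyFun_mul _ _ _) (integrableOn_polyFun_mul _ _ _))
      (fun c p q => by
        simp only [Submodule.coe_smul, polyFun_smul, mul_assoc, integral_const_mul, smul_eq_mul])
      (fun p q q' => by
        simp only [Submodule.coe_add, polyFun_add, mul_add]
        exact integral_add (integrableOn_polyFun_mul _ _ _) (integrableOn_polyFun_mul _ _ _))
      (fun c p q => by
        simp only [Submodule.coe_smul, polyFun_smul, mul_left_comm _ c, integral_const_mul,
          smul_eq_mul])
  let L : Module.Dual ℝ (Poly m) :=
    { toFun := fun φ => weakLaplacianRhs T ν v K φ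
      map_add' := fun φ ψ => weakLaplacianRhs_add hK ν v φ ψ
      map_smul' := fun c φ => weakLaplacianRhs_smul T K ν v c φ }
  have hinj : Function.Injective B := by
    rw [injective_iff_map_eq_zero]
    intro p hp
    exact Subtype.ext (eq_zero_of_integral_sq hint (LinearMap.congr_fun hp p))
  have hfin : FiniteDimensional ℝ (Poly m) := inferInstance
  have hsurj : Function.Surjective B :=
    (LinearMap.injective_iff_surjective_of_finrank_eq_finrank
      (Subspace.dual_finrank_eq (K := ℝ) (V := Poly m)).symm).1 hinj
  obtain ⟨d, hd⟩ := hsurj L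
  refine ⟨d, ⟨d.2, fun φ hφ => LinearMap.congr_fun hd ⟨φ, hφ⟩⟩, fun d' hd' => ?_⟩
  have : (⟨d', hd'.1⟩ : Poly m) = d := hinj <| LinearMap.ext fun φ =>
    (hd'.2 φ φ.2).trans (LinearMap.congr_fun hd φ).symm
  exact congrArg Subtype.val this

/-- The characteristic properties of the outward unit normal. -/
lemma outwardNormal_spec {T : Triangulation Ω} {K e : Finset Plane} (hK : K ∈ T.triangles)
    (he : e ∈ edgesOf K) :
    ‖outwardNormal K e‖ = 1 ∧
      (∀ x ∈ e, ∀ y ∈ e, inner ℝ (outwardNormal K e) (y - x) = 0) ∧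
      ∀ x ∈ e, ∀ z ∈ K, z ∉ e → inner ℝ (outwardNormal K e) (z - x) < 0 := by
  rw [T.mem_triangles] at hK
  rw [edgesOf, Finset.mem_powersetCard] at he
  obtain ⟨hind, hcard⟩ := And.intro (T.indep hK.1) hK.2
  obtain ⟨a, b, hab, rfl⟩ := Finset.card_eq_two.1 he.2
  have haK : a ∈ K := he.1 (by simp)
  have hbK : b ∈ K := he.1 (by simp)
  obtain ⟨c, hc⟩ : ∃ c, ∀ z, (z ∈ K ∧ z ∉ ({a, b} : Finset Plane)) ↔ z = c := by
    classical
    obtain ⟨c, hc⟩ := Finset.card_eq_one.1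
      (show (K \ {a, b}).card = 1 by rw [Finset.card_sdiff_of_subset he.1, hcard, he.2])
    exact ⟨c, fun z => by rw [← Finset.mem_sdiff, hc, Finset.mem_singleton]⟩
  obtain ⟨hcK, hcab⟩ := (hc c).2 rfl
  set S : Submodule ℝ Plane := vectorSpan ℝ (({a, b} : Finset Plane) : Set Plane) with hS
  have hba : b - a ∈ S := vsub_mem_vectorSpan ℝ (by simp) (by simp)
  set w : Plane := Sᗮ.starProjection (a - c) with hw
  have hwS : ∀ y ∈ S, inner ℝ w y = 0 := fun y hy =>
    (Submodule.mem_orthogonal' S w).1 (Submodule.starProjection_apply_mem _ _) y hy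
  have hb : Sᗮ.starProjection (b - c) = w := by
    have h0 : Sᗮ.starProjection (b - a) = 0 :=
      Submodule.starProjection_orthogonal_apply_eq_zero hba
    rw [show b - c = (b - a) + (a - c) by abel, map_add, h0, zero_add]
  have hout : outwardNormal K {a, b} = ‖(2 : ℝ) • w‖⁻¹ • ((2 : ℝ) • w) := by
    have h1 : ∀ inst : DecidableEq Plane, K \ {a, b} = {c} := fun inst => by
      ext z
      have := hc z
      simp only [Finset.mem_sdiff, Finset.mem_insert, Finset.mem_singleton] at this ⊢
      exact this
    simp only [outwardNormal, h1, Finset.sum_singleton, Finset.sum_pair hab, map_add]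
    change ‖w + Sᗮ.starProjection (b - c)‖⁻¹ • (w + Sᗮ.starProjection (b - c)) = _
    rw [hb, two_smul]
  have hw0 : w ≠ 0 := by
    intro h0
    have h1 : a - c ∈ S := by
      have h2 := (Submodule.starProjection_apply_eq_zero_iff Sᗮ).1 h0
      rwa [Submodule.orthogonal_orthogonal] at h2
    have h3 : c ∈ affineSpan ℝ (({a, b} : Finset Plane) : Set Plane) := by
      have ha : a ∈ affineSpan ℝ (({a, b} : Finset Plane) : Set Plane) :=
        subset_affineSpan ℝ _ (by simp)
      have h4 := AffineSubspace.vadd_mem_of_mem_direction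
        (by rw [direction_affineSpan]; exact S.neg_mem h1) ha
      simpa using h4
    have h5 := hind.notMem_affineSpan_sdiff ⟨c, hcK⟩ {⟨a, haK⟩, ⟨b, hbK⟩}
    refine h5 ?_
    have hne : (⟨c, hcK⟩ : K) ∉ ({⟨a, haK⟩, ⟨b, hbK⟩} : Set K) := by
      simpa [Subtype.ext_iff] using hcab
    rw [Set.sdiff_singleton_eq_self hne]
    simpa [Set.image_pair] using h3
  have hpos : 0 < ‖(2 : ℝ) • w‖⁻¹ := inv_pos.2 (norm_pos_iff.2 (smul_ne_zero two_ne_zero hw0))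
  have hww : inner ℝ w (c - a) < 0 := by
    have h1 : inner ℝ w (a - c) = inner ℝ w w := by
      have h2 : inner ℝ w ((a - c) - w) = 0 :=
        Submodule.sub_starProjection_mem_orthogonal (K := Sᗮ) (a - c) w
          (Submodule.starProjection_apply_mem _ _)
      rw [inner_sub_right] at h2
      linarith
    have h3 : 0 < inner ℝ w w := real_inner_self_pos.2 hw0
    rw [← neg_sub, inner_neg_right, h1]
    linarith
  rw [hout]
  refine ⟨?_, fun x hx y hy => ?_, fun x hx z hz hze => ?_⟩
  · rw [norm_smul, norm_inv, norm_norm, inv_mul_cancel₀ (inv_pos.1 hpos).ne']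
  · rw [inner_smul_left, inner_smul_left, hwS (y - x) (vsub_mem_vectorSpan ℝ (by simpa using hy)
      (by simpa using hx))]
    simp
  · obtain rfl := (hc z).1 ⟨hz, hze⟩
    have h1 : inner ℝ w (z - x) = inner ℝ w (z - a) := by
      rw [show z - x = (z - a) - (x - a) by abel, inner_sub_right,
        hwS (x - a) (vsub_mem_vectorSpan ℝ (by simpa using hx) (by simp)), sub_zero]
    rw [inner_smul_left, inner_smul_left, h1]
    simp only [conj_trivial]
    exact mul_neg_of_pos_of_neg hpos (by linarith)

end SFC0WG

end

namespace SFC0WG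

variable {Ω : Set Plane}

/-! ### Integrals over segments -/

/-! The form `Ah` is the broken `L²` inner product pulled back along the linear map `v ↦ Δ_w v` from
`V_h^0` into a finite product of polynomial spaces. If this map is injective, then `V_h^0` is
finite-dimensional, `Ah` is positive definite, and every linear functional, in particular `v ↦ ∫ f
v₀`, is represented by exactly one `u`. All the work lies in the injectivity,
`eq_zero_of_weakLaplacian_eq_zero`.

Let `Δ_w v = 0` and let `p` be the polynomial `v₀` on a triangle `K`. Green's formula turns the
definition of `Δ_w` into `∫_K φ Δp = ∑_e ∫_e φ r_e` with `r_e = ∂ₙp - vₙ (nₑ · n)`, for all `φ` of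
degree at most `k + 3`. Since `Δp` has degree at most `k` and `r_e` at most `k + 1`, this degree is
just large enough for two choices of `φ`: the cubic bubble of `K` times `Δp`, which gives `Δp = 0`,
and then the product of the edge functions of the two other sides times `r_e`, which gives `r_e = 0`
on `e` (`eq_zero_of_bubble`). So `v₀` is harmonic on each triangle, with normal derivative `vₙ (nₑ ·
n)`.

The function `vₙ` is single-valued on edges and the outward normals of the adjacent triangles cancel
on interior edges (`normalJump_eq_zero`). Summing over the triangles gives `∫ ∇φ · ∇v₀ = 0` for all
test functions `φ` on `Ω`. Letting `φ` run through the approximants of `v₀` in `H¹₀(Ω)` yields `∇v₀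
= 0`, hence `v₀ = 0` by a Poincaré inequality; traces of `v₀` never enter. Finally `vₙ (nₑ · n) = 0`
with `nₑ · n ≠ 0`, so `vₙ = 0`. -/

lemma hausdorffMeasure_restrict_segment (a b : Plane) :
    (μH[1] : Measure Plane).restrict (segment ℝ a b) =
      nndist a b • (volume.restrict (Set.Icc (0 : ℝ) 1)).map (AffineMap.lineMap a b) := by
  have hm : Measurable (AffineMap.lineMap a b : ℝ → Plane) :=
    (AffineMap.lineMap_continuous (R := ℝ)).measurable
  ext s hs
  rw [Measure.restrict_apply hs, Measure.smul_apply, Measure.map_apply hm hs,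
    Measure.restrict_apply (hm hs), segment_eq_image_lineMap, ← hausdorffMeasure_real,
    ← hausdorffMeasure_lineMap_image, Set.image_preimage_inter]

lemma setIntegral_segment (a b : Plane) {F : Plane → ℝ} (hF : Continuous F) :
    ∫ x in segment ℝ a b, F x ∂(μH[1] : Measure Plane) =
      dist a b * ∫ t in (0 : ℝ)..1, F (AffineMap.lineMap a b t) := by
  have hm : Measurable (AffineMap.lineMap a b : ℝ → Plane) :=
    (AffineMap.lineMap_continuous (R := ℝ)).measurable
  rw [hausdorffMeasure_restrict_segment, integral_smul_nnreal_measure,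
    integral_map hm.aemeasurable hF.aestronglyMeasurable,
    intervalIntegral.integral_of_le zero_le_one, integral_Icc_eq_integral_Ioc]
  rfl

lemma hull_pair (a b : Plane) : hull {a, b} = segment ℝ a b := by
  simp [hull, convexHull_pair]

/-! ### The divergence theorem on a triangle -/

/-- The determinant of two plane vectors. -/
def cross (u w : Plane) : ℝ := u 0 * w 1 - u 1 * w 0

/-- The linear map that sends the standard basis to `u`, `w`. -/
noncomputable def frame (u w : Plane) : Plane →ₗ[ℝ] Plane :=
  Matrix.toLin (EuclideanSpace.basisFun (Fin 2) ℝ).toBasis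
    (EuclideanSpace.basisFun (Fin 2) ℝ).toBasis !![u 0, w 0; u 1, w 1]

lemma frame_apply (u w y : Plane) : frame u w y = y 0 • u + y 1 • w := by
  ext i
  fin_cases i <;>
  simp [frame, Matrix.toLin_apply, Matrix.mulVec, dotProduct, Fin.sum_univ_two] <;> ring

lemma det_frame (u w : Plane) : LinearMap.det (frame u w) = cross u w := by
  simp [frame, LinearMap.det_toLin, Matrix.det_fin_two, cross]
  ring

/-- Coordinates of the plane as a pair, a measure-preserving equivalence. -/
noncomputable def pairEquiv : Plane ≃ᵐ ℝ × ℝ :=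
  (MeasurableEquiv.toLp 2 (Fin 2 → ℝ)).symm.trans MeasurableEquiv.finTwoArrow

lemma measurePreserving_pairEquiv : MeasurePreserving pairEquiv :=
  (EuclideanSpace.volume_preserving_symm_measurableEquiv_toLp (Fin 2)).trans
    (volume_preserving_finTwoArrow ℝ)

lemma pairEquiv_apply (y : Plane) : pairEquiv y = (y 0, y 1) := rfl

/-- The reference triangle. -/
def refTriangle : Set (ℝ × ℝ) := {z | 0 ≤ z.1 ∧ 0 ≤ z.2 ∧ z.1 + z.2 ≤ 1}

lemma isClosed_refTriangle : IsClosed refTriangle :=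
  (isClosed_le continuous_const continuous_fst).inter
    ((isClosed_le continuous_const continuous_snd).inter
      (isClosed_le (continuous_fst.add continuous_snd) continuous_const))

lemma isCompact_refTriangle : IsCompact refTriangle := by
  refine (isCompact_Icc (a := ((0 : ℝ), (0 : ℝ))) (b := (1, 1))).of_isClosed_subset
    isClosed_refTriangle ?_
  rintro ⟨s, t⟩ ⟨h1, h2, h3⟩
  simp only at h1 h2 h3
  exact ⟨⟨h1, h2⟩, ⟨by simp; linarith, by simp; linarith⟩⟩

lemma hull_triple_eq_image (a b c : Plane) :
    convexHull ℝ {a, b, c} =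
      (fun y => a + frame (b - a) (c - a) y) '' (pairEquiv ⁻¹' refTriangle) := by
  ext x
  rw [convexHull_insert (by simp), convexHull_pair, mem_convexJoin]
  simp only [Set.mem_singleton_iff, exists_eq_left]
  constructor
  · rintro ⟨z, ⟨p, q, hp, hq, hpq, rfl⟩, r, s, hr, hs, hrs, rfl⟩
    refine ⟨!₂[s * p, s * q], ?_, ?_⟩
    · refine ⟨?_, ?_, ?_⟩ <;> simp [pairEquiv_apply]
      · positivity
      · positivity
      · rw [← mul_add, hpq]; linarith
    · obtain rfl : r = 1 - s := by linarith
      obtain rfl : p = 1 - q := by linarith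
      simp only [frame_apply]
      ext i
      simp
      ring
  · rintro ⟨y, ⟨h1, h2, h3⟩, rfl⟩
    simp only [pairEquiv_apply] at h1 h2 h3
    have hs : 0 ≤ y 0 + y 1 := by positivity
    -- The point of `[b, c]` on the ray from `a` is found by dividing by `y 0 + y 1`. At the vertex
    -- `a` itself this is undefined, and any point of `[b, c]`, such as `b`, will do.
    rcases hs.eq_or_lt with h0 | h0
    · refine ⟨b, left_mem_segment ℝ b c, ?_⟩
      have e0 : y 0 = 0 := by linarith
      have e1 : y 1 = 0 := by linarith
      simpa [frame_apply, e0, e1] using left_mem_segment ℝ a b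
    · refine ⟨(y 0 / (y 0 + y 1)) • b + (y 1 / (y 0 + y 1)) • c,
        ⟨_, _, by positivity, by positivity, by field_simp, rfl⟩,
        1 - (y 0 + y 1), y 0 + y 1, by linarith, hs, by ring, ?_⟩
      simp only [frame_apply]
      ext i
      simp
      field_simp
      ring

lemma setIntegral_triangle (a b c : Plane) (hd : cross (b - a) (c - a) ≠ 0) (h : Plane → ℝ) :
    ∫ x in convexHull ℝ {a, b, c}, h x =
      |cross (b - a) (c - a)| *
        ∫ z in refTriangle, h (a + (z.1 • (b - a) + z.2 • (c - a))) := by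
  have hmeas : MeasurableSet (pairEquiv ⁻¹' refTriangle) :=
    pairEquiv.measurable isClosed_refTriangle.measurableSet
  have hinj : Function.Injective (frame (b - a) (c - a)) := by
    have : IsUnit (frame (b - a) (c - a)) := by
      rw [LinearMap.isUnit_iff_isUnit_det, det_frame]
      exact hd.isUnit
    exact ((Module.End.isUnit_iff _).1 this).1
  rw [hull_triple_eq_image, integral_image_eq_integral_abs_det_fderiv_smul volume hmeas
    (f := fun y => a + frame (b - a) (c - a) y)
    (f' := fun _ => LinearMap.toContinuousLinearMap (frame (b - a) (c - a)))
    (fun y _ => ((LinearMap.toContinuousLinearMap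
      (frame (b - a) (c - a))).hasFDerivAt.const_add a).hasFDerivWithinAt)
    (fun y _ z _ hyz => hinj (add_left_cancel hyz))]
  have hdet : (LinearMap.toContinuousLinearMap (frame (b - a) (c - a))).det =
      cross (b - a) (c - a) := by
    rw [← det_frame]; rfl
  simp only [hdet, smul_eq_mul, integral_const_mul, frame_apply]
  congr 1
  exact measurePreserving_pairEquiv.setIntegral_preimage_emb pairEquiv.measurableEmbedding
    (fun z => h (a + (z.1 • (b - a) + z.2 • (c - a)))) refTriangle

/-- In the affine chart the direction `b - a` is the first coordinate `s`, so Fubini and the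
fundamental theorem of calculus on the slice `0 ≤ s ≤ 1 - t` leave the end values, which lie on `[b,
c]` and `[a, c]`. The side `[a, b]` is parallel to the direction and does not contribute. -/
lemma integral_fderiv_triangle (a b c : Plane) (hd : cross (b - a) (c - a) ≠ 0)
    {F : Plane → ℝ} (hF : ContDiff ℝ 1 F) :
    ∫ x in convexHull ℝ {a, b, c}, fderiv ℝ F x (b - a) =
      |cross (b - a) (c - a)| *
        ((∫ t in (0 : ℝ)..1, F (AffineMap.lineMap b c t)) -
          ∫ t in (0 : ℝ)..1, F (AffineMap.lineMap a c t)) := by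
  have hF' : Continuous fun x => fderiv ℝ F x (b - a) :=
    (hF.continuous_fderiv one_ne_zero).clm_apply continuous_const
  rw [setIntegral_triangle a b c hd]
  congr 1
  set G : ℝ × ℝ → ℝ := fun z => fderiv ℝ F (a + (z.1 • (b - a) + z.2 • (c - a))) (b - a) with hG
  have hGc : Continuous G := hF'.comp (by fun_prop)
  rw [← integral_indicator isClosed_refTriangle.measurableSet, Measure.volume_eq_prod,
    integral_prod_symm _ ((integrable_indicator_iff isClosed_refTriangle.measurableSet).2
      (hGc.continuousOn.integrableOn_compact isCompact_refTriangle))]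
  have key : ∀ t : ℝ, ∫ s, refTriangle.indicator G (s, t) =
      (Set.Icc (0 : ℝ) 1).indicator
        (fun t => F (AffineMap.lineMap b c t) - F (AffineMap.lineMap a c t)) t := by
    intro t
    by_cases ht : t ∈ Set.Icc (0 : ℝ) 1
    · rw [Set.indicator_of_mem ht]
      have e1 : (fun s => refTriangle.indicator G (s, t)) =
          (Set.Icc 0 (1 - t)).indicator fun s => G (s, t) := by
        ext s
        have h : (s, t) ∈ refTriangle ↔ s ∈ Set.Icc 0 (1 - t) :=
          ⟨fun h => ⟨h.1, by linarith [h.2.2]⟩, fun h => ⟨h.1, ht.1, by linarith [h.2]⟩⟩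
        by_cases hs : s ∈ Set.Icc 0 (1 - t)
        · rw [Set.indicator_of_mem hs, Set.indicator_of_mem (h.2 hs)]
        · rw [Set.indicator_of_notMem hs, Set.indicator_of_notMem (mt h.1 hs)]
      rw [e1, integral_indicator measurableSet_Icc, integral_Icc_eq_integral_Ioc,
        ← intervalIntegral.integral_of_le (by linarith [ht.2])]
      rw [intervalIntegral.integral_eq_sub_of_hasDerivAt
        (f := fun s => F (a + (s • (b - a) + t • (c - a))))]
      · congr 2
        · ext i; simp [AffineMap.lineMap_apply]; ring
        · simp [AffineMap.lineMap_apply, add_comm]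
      · intro s _
        have h1 : HasDerivAt (fun s : ℝ => a + (s • (b - a) + t • (c - a))) (b - a) s := by
          simpa using (((hasDerivAt_id s).smul_const (b - a)).add_const
            (t • (c - a))).const_add a
        exact ((hF.differentiable one_ne_zero _).hasFDerivAt).comp_hasDerivAt s h1
      · exact (hGc.comp (by fun_prop)).intervalIntegrable _ _
    · rw [Set.indicator_of_notMem ht]
      have e1 : (fun s => refTriangle.indicator G (s, t)) = fun _ => 0 := by
        ext s
        refine Set.indicator_of_notMem ?_ _
        rintro ⟨h1, h2, h3⟩
        exact ht ⟨h2, by simp at *; linarith⟩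
      rw [e1, integral_zero]
  simp_rw [key]
  have hl : ∀ p q : Plane, Continuous fun t : ℝ => F (AffineMap.lineMap p q t) := fun p q =>
    hF.continuous.comp AffineMap.lineMap_continuous
  rw [integral_indicator measurableSet_Icc, integral_Icc_eq_integral_Ioc,
    ← intervalIntegral.integral_of_le zero_le_one,
    intervalIntegral.integral_sub ((hl b c).intervalIntegrable _ _)
      ((hl a c).intervalIntegrable _ _)]

lemma intervalIntegral_lineMap_symm (a b : Plane) (F : Plane → ℝ) :
    ∫ t in (0 : ℝ)..1, F (AffineMap.lineMap a b t) =
      ∫ t in (0 : ℝ)..1, F (AffineMap.lineMap b a t) := by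
  have := intervalIntegral.integral_comp_sub_left (a := 0) (b := 1)
    (fun t => F (AffineMap.lineMap a b t)) (1 : ℝ)
  simp only [AffineMap.lineMap_apply_one_sub, sub_self, sub_zero] at this
  exact this.symm

/-! ### Determinants, normals and bases in the plane -/

lemma inner_plane (x y : Plane) : inner ℝ x y = x 0 * y 0 + x 1 * y 1 := by
  simp [PiLp.inner_apply, Fin.sum_univ_two]; ring

lemma norm_sq_plane (x : Plane) : ‖x‖ ^ 2 = x 0 ^ 2 + x 1 ^ 2 := by
  rw [EuclideanSpace.norm_sq_eq]; simp [Fin.sum_univ_two]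

/-- Base times height is the determinant. -/
lemma norm_mul_inner_normal {n u z : Plane} (hn : ‖n‖ = 1) (hu : inner ℝ n u = 0)
    (hz : inner ℝ n z < 0) : ‖u‖ * inner ℝ n z = -|cross u z| := by
  have h1 : (‖u‖ * inner ℝ n z) ^ 2 = cross u z ^ 2 := by
    have hn2 : n 0 ^ 2 + n 1 ^ 2 = 1 := by rw [← norm_sq_plane, hn]; norm_num
    rw [inner_plane] at hu
    rw [mul_pow, norm_sq_plane, inner_plane, cross]
    -- As `u ⟂ n`, `u` is parallel to the rotated normal, and the determinant factors into `cross u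
    -- n` and the normal component of `z`. By `hB` the first factor is `±‖u‖`.
    have hA : u 0 * z 1 - u 1 * z 0 =
        (u 0 * n 1 - u 1 * n 0) * (n 0 * z 0 + n 1 * z 1) := by
      linear_combination (-(u 0 * z 1 - u 1 * z 0)) * hn2 + (n 0 * z 1 - n 1 * z 0) * hu
    have hB : (u 0 * n 1 - u 1 * n 0) ^ 2 = u 0 ^ 2 + u 1 ^ 2 := by
      linear_combination (u 0 ^ 2 + u 1 ^ 2) * hn2 - (n 0 * u 0 + n 1 * u 1) * hu
    rw [hA, mul_pow, hB]
  have h2 : |‖u‖ * inner ℝ n z| = |cross u z| := (sq_eq_sq_iff_abs_eq_abs _ _).1 h1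
  rw [← h2, abs_of_nonpos (mul_nonpos_of_nonneg_of_nonpos (norm_nonneg _) hz.le), neg_neg]

/-- Cramer's rule. -/
lemma exists_eq_smul_add_smul {u w : Plane} (h : cross u w ≠ 0) (x : Plane) :
    ∃ α β : ℝ, x = α • u + β • w := by
  refine ⟨cross x w / cross u w, cross u x / cross u w, ?_⟩
  have : cross u w • x = cross x w • u + cross u x • w := by
    ext i; fin_cases i <;> simp [cross] <;> ring
  rw [div_eq_inv_mul, div_eq_inv_mul, mul_smul, mul_smul, ← smul_add, ← this, smul_smul,
    inv_mul_cancel₀ h, one_smul]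

lemma edgesOf_triple {a b c : Plane} (hab : a ≠ b) (hac : a ≠ c) (hbc : b ≠ c) :
    edgesOf {a, b, c} = {{a, b}, {a, c}, {b, c}} := by
  have h : ({{a, b}, {a, c}, {b, c}} : Finset (Finset Plane)) ⊆ edgesOf {a, b, c} := by
    intro e he
    simp only [Finset.mem_insert, Finset.mem_singleton] at he
    rw [edgesOf, Finset.mem_powersetCard]
    rcases he with rfl | rfl | rfl
    · exact ⟨by intro x; simp; tauto, Finset.card_pair hab⟩
    · exact ⟨by intro x; simp; tauto, Finset.card_pair hac⟩
    · exact ⟨by intro x; simp; tauto, Finset.card_pair hbc⟩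
  refine (Finset.eq_of_subset_of_card_le h ?_).symm
  rw [edgesOf, Finset.card_powersetCard, Finset.card_eq_three.2 ⟨a, b, c, hab, hac, hbc, rfl⟩]
  refine (Finset.card_eq_three.2 ⟨_, _, _, ?_, ?_, ?_, rfl⟩).ge
  · intro h
    have : b ∈ ({a, c} : Finset Plane) := h ▸ (by simp)
    simp at this; tauto
  · intro h
    have : a ∈ ({b, c} : Finset Plane) := h ▸ (by simp)
    simp at this; tauto
  · intro h
    have : a ∈ ({b, c} : Finset Plane) := h ▸ (by simp)
    simp at this; tauto

lemma sum_edgesOf_triple {a b c : Plane} (hab : a ≠ b) (hac : a ≠ c) (hbc : b ≠ c)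
    (g : Finset Plane → ℝ) :
    ∑ e ∈ edgesOf {a, b, c}, g e = g {a, b} + g {a, c} + g {b, c} := by
  have h1 : ({a, b} : Finset Plane) ∉ ({{a, c}, {b, c}} : Finset (Finset Plane)) := by
    simp only [Finset.mem_insert, Finset.mem_singleton, not_or]
    constructor
    · intro h
      have : b ∈ ({a, c} : Finset Plane) := h ▸ (by simp)
      simp at this; tauto
    · intro h
      have : a ∈ ({b, c} : Finset Plane) := h ▸ (by simp)
      simp at this; tauto
  have h2 : ({a, c} : Finset Plane) ≠ {b, c} := by
    intro h
    have : a ∈ ({b, c} : Finset Plane) := h ▸ (by simp)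
    simp at this; tauto
  rw [edgesOf_triple hab hac hbc, Finset.sum_insert h1, Finset.sum_pair h2, add_assoc]

lemma integrableOn_hull {F : Plane → ℝ} (hF : Continuous F) (K : Finset Plane) :
    IntegrableOn F (hull K) :=
  hF.continuousOn.integrableOn_compact (isCompact_hull K)

/-- The divergence theorem on a triangle of the mesh. -/
lemma integral_fderiv_eq_sum_edges {T : Triangulation Ω} {K : Finset Plane}
    (hK : K ∈ T.triangles) {F : Plane → ℝ} (hF : ContDiff ℝ 1 F) (w : Plane) :
    ∫ x in hull K, fderiv ℝ F x w =
      ∑ e ∈ edgesOf K, inner ℝ w (outwardNormal K e) *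
        ∫ x in hull e, F x ∂(μH[1] : Measure Plane) := by
  obtain ⟨a, b, c, hab, hac, hbc, rfl⟩ := Finset.card_eq_three.1 (T.mem_triangles.1 hK).2
  have hspec := fun e he => outwardNormal_spec (T := T) (e := e) hK he
  have hE := edgesOf_triple hab hac hbc
  obtain ⟨n1, o1, s1⟩ := hspec {a, b} (by simp [hE])
  obtain ⟨n2, o2, s2⟩ := hspec {a, c} (by simp [hE])
  obtain ⟨n3, o3, s3⟩ := hspec {b, c} (by simp [hE])
  rw [sum_edgesOf_triple hab hac hbc]
  set N1 := outwardNormal {a, b, c} {a, b}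
  set N2 := outwardNormal {a, b, c} {a, c}
  set N3 := outwardNormal {a, b, c} {b, c}
  have o1 : inner ℝ N1 (b - a) = 0 := o1 a (by simp) b (by simp)
  have o2 : inner ℝ N2 (c - a) = 0 := o2 a (by simp) c (by simp)
  have o3 : inner ℝ N3 (c - b) = 0 := o3 b (by simp) c (by simp)
  have s1 : inner ℝ N1 (c - a) < 0 := s1 a (by simp) c (by simp) (by simp [hac.symm, hbc.symm])
  have s2 : inner ℝ N2 (b - a) < 0 := s2 a (by simp) b (by simp) (by simp [hab.symm, hbc])
  have s3 : inner ℝ N3 (a - b) < 0 := s3 b (by simp) a (by simp) (by simp [hab, hac])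
  set D := cross (b - a) (c - a) with hD
  have c2 : cross (c - a) (b - a) = -D := by simp only [hD, cross]; ring
  have c3 : cross (c - b) (a - b) = D := by simp [hD, cross]; ring
  have m1 := norm_mul_inner_normal n1 o1 s1
  have m2 := norm_mul_inner_normal n2 o2 s2
  have m3 := norm_mul_inner_normal n3 o3 s3
  rw [c2, abs_neg] at m2
  rw [c3] at m3
  -- The triangle is nondegenerate because the height over `[a, b]` is strictly nonzero.
  have hD0 : D ≠ 0 := by
    have h1 : ‖b - a‖ * inner ℝ N1 (c - a) < 0 :=
      mul_neg_of_pos_of_neg (norm_pos_iff.2 (sub_ne_zero.2 hab.symm)) s1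
    intro h0
    rw [← hD, h0, abs_zero] at m1
    linarith
  simp only [hull_pair, setIntegral_segment _ _ hF.continuous]
  have hK3 : hull {a, b, c} = convexHull ℝ {a, b, c} := by simp [hull]
  have G1 := integral_fderiv_triangle a b c hD0 hF
  have G2 := integral_fderiv_triangle a c b (by rw [c2]; exact neg_ne_zero.2 hD0) hF
  rw [show ({a, c, b} : Set Plane) = {a, b, c} by rw [Set.pair_comm], c2, abs_neg,
    intervalIntegral_lineMap_symm c b] at G2
  rw [← hD] at G1
  -- Both sides are linear in `w`, so the directions `b - a` and `c - a`, covered by `G1` and `G2`,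
  -- suffice. The relations `m1`, `m2`, `m3` then convert each edge length times normal component
  -- into `|D|`.
  obtain ⟨α, β, rfl⟩ := exists_eq_smul_add_smul hD0 w
  have hint : ∀ u, IntegrableOn (fun x => fderiv ℝ F x u) (convexHull ℝ {a, b, c}) := fun u => by
    rw [← hK3]
    exact integrableOn_hull ((hF.continuous_fderiv one_ne_zero).clm_apply continuous_const) _
  rw [hK3]
  simp only [map_add, map_smul, smul_eq_mul]
  rw [integral_add ((hint _).const_mul α) ((hint _).const_mul β), integral_const_mul,
    integral_const_mul, G1, G2]
  rw [inner_add_left, inner_add_left, inner_add_left]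
  simp only [real_inner_smul_left]
  have e1 : ∀ N : Plane, inner ℝ (b - a) N = inner ℝ N (b - a) := fun N => real_inner_comm _ _
  have e2 : ∀ N : Plane, inner ℝ (c - a) N = inner ℝ N (c - a) := fun N => real_inner_comm _ _
  have e3 : inner ℝ N3 (b - a) = - inner ℝ N3 (a - b) := by rw [← inner_neg_right, neg_sub]
  have e4 : inner ℝ N3 (c - a) = - inner ℝ N3 (a - b) := by
    rw [show c - a = (c - b) - (a - b) by abel, inner_sub_right, o3, zero_sub]
  rw [e1, e1, e1, e2, e2, e2, o1, o2, e3, e4, dist_comm a b, dist_comm a c, dist_comm b c,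
    dist_eq_norm, dist_eq_norm, dist_eq_norm]
  set I1 := ∫ t in (0 : ℝ)..1, F (AffineMap.lineMap a b t)
  set I2 := ∫ t in (0 : ℝ)..1, F (AffineMap.lineMap a c t)
  set I3 := ∫ t in (0 : ℝ)..1, F (AffineMap.lineMap b c t)
  linear_combination (-β * I1) * m1 - α * I2 * m2 + (α + β) * I3 * m3

/-! ### The triangles of the mesh tile `Ω` -/

/-- At most two points span a proper affine subspace of the plane, which is a null set. -/
lemma volume_hull_eq_zero {u : Finset Plane} (hu : u.card ≤ 2) : volume (hull u) = 0 := by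
  refine measure_mono_null (convexHull_subset_affineSpan _)
    (Measure.addHaar_affineSubspace volume _ fun h => ?_)
  rcases u.eq_empty_or_nonempty with rfl | hne
  · simp at h
  · obtain ⟨n, hn⟩ : ∃ n, u.card = n + 1 := ⟨u.card - 1, by have := hne.card_pos; omega⟩
    have h1 := finrank_vectorSpan_range_le ℝ ((↑) : u → Plane) (n := n) (by simpa using hn)
    have h2 : vectorSpan ℝ (Set.range ((↑) : u → Plane)) = ⊤ := by
      rw [← direction_affineSpan]
      simp only [Subtype.range_coe_subtype]
      have : {x | x ∈ u} = (u : Set Plane) := rfl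
      rw [this, h, AffineSubspace.direction_top]
    rw [h2, finrank_top] at h1
    simp at h1
    omega

lemma inter_hull_subset (T : Triangulation Ω) {s t : Finset Plane} (hs : s ∈ T.faces)
    (ht : t ∈ T.faces) : hull s ∩ hull t ⊆ hull (s ∩ t) := by
  have := T.inter_subset_convexHull hs ht
  simpa [hull] using this

/-- Conformity puts the intersection inside the hull of the common vertices, and distinct triangles
share at most two. -/
lemma aedisjoint_hull (T : Triangulation Ω) {s t : Finset Plane} (hs : s ∈ T.triangles)
    (ht : t ∈ T.triangles) (hst : s ≠ t) : AEDisjoint volume (hull s) (hull t) := by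
  rw [T.mem_triangles] at hs ht
  refine measure_mono_null (inter_hull_subset T hs.1 ht.1) (volume_hull_eq_zero ?_)
  by_contra! h
  have h1 : s ∩ t = s := Finset.eq_of_subset_of_card_le Finset.inter_subset_left (by omega)
  have h2 : s ∩ t = t := Finset.eq_of_subset_of_card_le Finset.inter_subset_right (by omega)
  exact hst (h1.symm.trans h2)

lemma iUnion_triangles (T : Triangulation Ω) :
    ⋃ K : T.triangles, hull (K : Finset Plane) = closure Ω := by
  rw [← T.cover]
  apply Set.Subset.antisymm
  · exact Set.iUnion_subset fun K => Set.subset_biUnion_of_mem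
      (u := fun s => hull s) (T.mem_triangles.1 K.2).1
  · refine Set.iUnion₂_subset fun s hs => ?_
    obtain ⟨t, ht, hst, hc⟩ := T.pure s hs
    exact (convexHull_mono (by exact_mod_cast hst)).trans
      (Set.subset_iUnion (fun K : T.triangles => hull (K : Finset Plane))
        ⟨t, T.mem_triangles.2 ⟨ht, hc⟩⟩)

lemma hull_subset_closure (T : Triangulation Ω) {K : Finset Plane} (hK : K ∈ T.triangles) :
    hull K ⊆ closure Ω := by
  rw [← iUnion_triangles T]
  exact Set.subset_iUnion (fun K : T.triangles => hull (K : Finset Plane)) ⟨K, hK⟩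

lemma volume_frontier_eq_zero (T : Triangulation Ω) : volume (frontier Ω) = 0 := by
  obtain ⟨B, hB, h⟩ := T.boundary
  rw [h]
  refine (measure_biUnion_null_iff ((T.finite_faces.subset
    (hB.trans (Set.sep_subset _ _))).countable)).2 fun e he => ?_
  exact volume_hull_eq_zero (hB he).2.le

/-- The boundary is a finite union of edges, hence null. This passes from `closure Ω`, which the
triangles tile, to `Ω`, where the function spaces live. -/
lemma restrict_closure (T : Triangulation Ω) :
    volume.restrict (closure Ω) = volume.restrict Ω := by
  refine Measure.restrict_congr_set ?_
  refine ae_eq_set.2 ⟨measure_mono_null (t := frontier Ω)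
    (fun x hx => ⟨hx.1, fun h => hx.2 (interior_subset h)⟩) (volume_frontier_eq_zero T), ?_⟩
  rw [Set.sdiff_eq_empty.2 subset_closure, measure_empty]

lemma restrict_hull_le (T : Triangulation Ω) {K : Finset Plane} (hK : K ∈ T.triangles) :
    volume.restrict (hull K) ≤ volume.restrict Ω := by
  rw [← restrict_closure T]
  exact Measure.restrict_mono (hull_subset_closure T hK) le_rfl

lemma isBounded_of_triangulation (T : Triangulation Ω) : Bornology.IsBounded Ω := by
  refine Bornology.IsBounded.subset ?_ subset_closure
  rw [← T.cover, Bornology.isBounded_biUnion T.finite_faces]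
  exact fun s _ => (isCompact_hull s).isBounded

lemma setIntegral_eq_sum_triangles (T : Triangulation Ω) {h : Plane → ℝ}
    (hh : IntegrableOn h Ω) :
    ∫ x in Ω, h x = ∑ K ∈ T.triangles, ∫ x in hull K, h x := by
  have hh' : IntegrableOn h (closure Ω) := by rwa [IntegrableOn, restrict_closure T]
  rw [← restrict_closure T, ← iUnion_triangles T, integral_iUnion_ae, tsum_fintype]
  · exact Finset.sum_coe_sort T.triangles fun K => ∫ x in hull K, h x
  · exact fun K => (isCompact_hull _).measurableSet.nullMeasurableSet
  · exact fun K L hKL => aedisjoint_hull T K.2 L.2 fun h => hKL (Subtype.ext h)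
  · rwa [iUnion_triangles T]

/-! ### Cancellation of the outward normals on interior edges -/

/-- Integration by parts against the constant `1`. -/
lemma integral_fderiv_eq_zero {F : Plane → ℝ} (hF : ContDiff ℝ 1 F) (hc : HasCompactSupport F)
    (w : Plane) : ∫ x, fderiv ℝ F x w = 0 := by
  have h1 : Continuous fun x => fderiv ℝ F x w :=
    (hF.continuous_fderiv one_ne_zero).clm_apply continuous_const
  have := integral_mul_fderiv_eq_neg_fderiv_mul_of_integrable (μ := (volume : Measure Plane))
    (f := fun _ : Plane => (1 : ℝ)) (g := F) (v := w) (by simp)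
    (by simpa using h1.integrable_of_hasCompactSupport (hc.fderiv_apply (𝕜 := ℝ) w))
    (by simpa using hF.continuous.integrable_of_hasCompactSupport hc) (by simp)
    (fun x _ => hF.differentiable one_ne_zero x)
  simpa using this

lemma sum_integral_fderiv_eq_zero (T : Triangulation Ω) {F : Plane → ℝ} (hF : ContDiff ℝ 1 F)
    (hc : HasCompactSupport F) (hs : tsupport F ⊆ Ω) (w : Plane) :
    ∑ K ∈ T.triangles, ∫ x in hull K, fderiv ℝ F x w = 0 := by
  have h1 : Continuous fun x => fderiv ℝ F x w :=
    (hF.continuous_fderiv one_ne_zero).clm_apply continuous_const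
  rw [← setIntegral_eq_sum_triangles T
      (h1.integrable_of_hasCompactSupport (hc.fderiv_apply (𝕜 := ℝ) w)).integrableOn,
    setIntegral_eq_integral_of_forall_compl_eq_zero, integral_fderiv_eq_zero hF hc]
  intro x hx
  have : fderiv ℝ F x = 0 := by
    by_contra h
    exact hx (hs (support_fderiv_subset ℝ h))
  simp [this]

/-- Sums over the sides of all triangles can be arranged by edges. -/
lemma sum_triangles_edgesOf (T : Triangulation Ω) (g : Finset Plane → Finset Plane → ℝ) :
    ∑ K ∈ T.triangles, ∑ e ∈ edgesOf K, g K e =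
      ∑ e ∈ T.edges, ∑ K ∈ T.triangles with e ∈ edgesOf K, g K e := by
  refine Finset.sum_comm' fun K e => ?_
  simp only [Finset.mem_filter]
  exact ⟨fun h => ⟨⟨h.1, h.2⟩, T.edgesOf_subset h.1 h.2⟩, fun h => h.1⟩

/-- The sum of the outward normals on `e` of the triangles adjacent to `e`. -/
noncomputable def normalJump (T : Triangulation Ω) (e : Finset Plane) : Plane :=
  ∑ K ∈ T.triangles with e ∈ edgesOf K, outwardNormal K e

/-- The divergence theorem on each triangle, regrouped by edges, computes `∫_Ω ∂_w F`, which
vanishes for `F` compactly supported in `Ω`. Localizing `F` isolates a single edge. -/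
lemma sum_edges_inner_normalJump (T : Triangulation Ω) {F : Plane → ℝ} (hF : ContDiff ℝ 1 F)
    (hc : HasCompactSupport F) (hs : tsupport F ⊆ Ω) (w : Plane) :
    ∑ e ∈ T.edges, inner ℝ w (normalJump T e) *
      ∫ x in hull e, F x ∂(μH[1] : Measure Plane) = 0 := by
  have h := sum_integral_fderiv_eq_zero T hF hc hs w
  rw [Finset.sum_congr rfl fun K hK => integral_fderiv_eq_sum_edges hK hF w,
    sum_triangles_edgesOf] at h
  simpa only [normalJump, inner_sum, Finset.sum_mul] using h

lemma setIntegral_edge_pos {a b x : Plane} (hab : a ≠ b) (hx : x ∈ segment ℝ a b)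
    {F : Plane → ℝ} (hF : Continuous F) (h0 : ∀ y ∈ segment ℝ a b, 0 ≤ F y) (hFx : 0 < F x) :
    0 < ∫ y in segment ℝ a b, F y ∂(μH[1] : Measure Plane) := by
  rw [setIntegral_segment a b hF]
  rw [segment_eq_image_lineMap] at hx
  obtain ⟨t, ht, rfl⟩ := hx
  exact mul_pos (dist_pos.2 hab) (intervalIntegral.integral_pos zero_lt_one
    (hF.comp AffineMap.lineMap_continuous).continuousOn (fun s hs => h0 _ (lineMap_mem_segment ℝ a b ⟨hs.1.le, hs.2⟩)) ⟨t, ht, hFx⟩)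

/-- An analytic argument replaces the count of the triangles adjacent to `e`: a bump function around
a point of `e` that meets no other edge reduces `sum_edges_inner_normalJump` to the single term of
`e`. -/
lemma normalJump_eq_zero (T : Triangulation Ω) (hΩ : IsOpen Ω) {e : Finset Plane}
    (he : e ∈ T.edges) (hfr : ¬ hull e ⊆ frontier Ω) : normalJump T e = 0 := by
  obtain ⟨hef, hec⟩ := T.mem_edges.1 he
  obtain ⟨a, b, hab, rfl⟩ := Finset.card_eq_two.1 hec
  -- A point of `e` off the boundary lies in the open set `Ω`, and `e` is the closure of its
  -- relative interior, so `Ω` contains a point of `e` that is not an endpoint.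
  obtain ⟨x, hxΩ, hx⟩ : (Ω ∩ openSegment ℝ a b).Nonempty := by
    obtain ⟨y, hy, hyf⟩ := Set.not_subset.1 hfr
    have hyc : y ∈ closure Ω := by
      rw [← T.cover]
      exact Set.mem_biUnion hef hy
    have hyΩ : y ∈ Ω := by
      by_contra h
      exact hyf ⟨hyc, by rwa [hΩ.interior_eq]⟩
    rw [hull_pair, ← closure_openSegment] at hy
    exact mem_closure_iff.1 hy Ω hΩ hyΩ
  -- Another edge shares at most one vertex with `e`, so by conformity it meets `e` at most in an
  -- endpoint.
  have hxe : ∀ e' ∈ T.edges.erase {a, b}, x ∉ hull e' := by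
    intro e' he' hx'
    rw [Finset.mem_erase] at he'
    have h1 := inter_hull_subset T hef (T.mem_edges.1 he'.2).1
      ⟨hull_pair a b ▸ openSegment_subset_segment ℝ a b hx, hx'⟩
    have hna : x ≠ a := fun h => hab (left_mem_openSegment_iff.1 (h ▸ hx))
    have hnb : x ≠ b := fun h => hab (right_mem_openSegment_iff.1 (h ▸ hx))
    by_cases ha : a ∈ e'
    · by_cases hb : b ∈ e'
      · refine he'.1 (Finset.eq_of_subset_of_card_le ?_ ?_).symm
        · intro z hz
          simp only [Finset.mem_insert, Finset.mem_singleton] at hz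
          rcases hz with rfl | rfl <;> assumption
        · rw [hec, (T.mem_edges.1 he'.2).2]
      · have : ({a, b} : Finset Plane) ∩ e' ⊆ {a} := by
          intro z hz
          simp only [Finset.mem_inter, Finset.mem_insert, Finset.mem_singleton] at hz ⊢
          rcases hz with ⟨rfl | rfl, h⟩
          · rfl
          · exact absurd h hb
        have := convexHull_mono (𝕜 := ℝ) (Finset.coe_subset.2 this) h1
        simp at this
        exact hna this
    · have : ({a, b} : Finset Plane) ∩ e' ⊆ {b} := by
        intro z hz
        simp only [Finset.mem_inter, Finset.mem_insert, Finset.mem_singleton] at hz ⊢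
        rcases hz with ⟨rfl | rfl, h⟩
        · exact absurd h ha
        · rfl
      have := convexHull_mono (𝕜 := ℝ) (Finset.coe_subset.2 this) h1
      simp at this
      exact hnb this
  have hU : Ω ∩ ⋂ e' ∈ T.edges.erase {a, b}, (hull e')ᶜ ∈ 𝓝 x := by
    refine IsOpen.mem_nhds (hΩ.inter (isOpen_biInter_finset fun e' _ =>
      (isCompact_hull e').isClosed.isOpen_compl)) ⟨hxΩ, ?_⟩
    simp only [Set.mem_iInter]
    exact hxe
  obtain ⟨F, hFs, hFc, hF, hFr, hFx⟩ := exists_contDiff_tsupport_subset (n := 1) hU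
  have hF' : ContDiff ℝ 1 F := hF
  have hpos : 0 < ∫ y in hull {a, b}, F y ∂(μH[1] : Measure Plane) := by
    rw [hull_pair]
    exact setIntegral_edge_pos hab (openSegment_subset_segment ℝ a b hx) hF'.continuous
      (fun y _ => (hFr (Set.mem_range_self y)).1) (by rw [hFx]; exact one_pos)
  -- The direction is the jump itself, so the surviving term is its squared norm times a positive
  -- integral.
  have hsum := sum_edges_inner_normalJump T hF' hFc (hFs.trans Set.inter_subset_left)
    (normalJump T {a, b})
  rw [← Finset.add_sum_erase _ _ he, Finset.sum_eq_zero, add_zero] at hsum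
  · exact inner_self_eq_zero.1 ((mul_eq_zero.1 hsum).resolve_right hpos.ne')
  · intro e' he'
    rw [setIntegral_eq_zero_of_forall_eq_zero, mul_zero]
    intro y hy
    by_contra h
    have := (hFs (subset_tsupport F h)).2
    simp only [Set.mem_iInter] at this
    exact this e' he' hy

/-! ### Derivatives and degrees of polynomials -/

lemma polyFun_mul (p q : MvPolynomial (Fin 2) ℝ) (x : Plane) :
    polyFun (p * q) x = polyFun p x * polyFun q x := by simp [polyFun]

lemma polyFun_sum {ι : Type*} (s : Finset ι) (f : ι → MvPolynomial (Fin 2) ℝ) (x : Plane) :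
    polyFun (∑ i ∈ s, f i) x = ∑ i ∈ s, polyFun (f i) x := by simp [polyFun]

lemma polyFun_prod {ι : Type*} (s : Finset ι) (f : ι → MvPolynomial (Fin 2) ℝ) (x : Plane) :
    polyFun (∏ i ∈ s, f i) x = ∏ i ∈ s, polyFun (f i) x := by simp [polyFun]

lemma polyFun_C (c : ℝ) (x : Plane) : polyFun (MvPolynomial.C c) x = c := by simp [polyFun]

lemma polyFun_zero (x : Plane) : polyFun 0 x = 0 := by simp [polyFun]

/-- The gradient of a polynomial. -/
noncomputable def polyGrad (p : MvPolynomial (Fin 2) ℝ) (x : Plane) : Plane :=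
  WithLp.toLp 2 fun i => polyFun (MvPolynomial.pderiv i p) x

lemma polyGrad_apply (p : MvPolynomial (Fin 2) ℝ) (x : Plane) (i : Fin 2) :
    polyGrad p x i = polyFun (MvPolynomial.pderiv i p) x := rfl

lemma continuous_polyGrad (p : MvPolynomial (Fin 2) ℝ) : Continuous (polyGrad p) :=
  (PiLp.continuous_toLp 2 _).comp (continuous_pi fun _ => continuous_polyFun _)

lemma hasGradientAt_polyFun (p : MvPolynomial (Fin 2) ℝ) (x : Plane) :
    HasGradientAt (polyFun p) (polyGrad p x) x := by
  induction p using MvPolynomial.induction_on with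
  | C c =>
    have h1 : polyFun (MvPolynomial.C c) = fun _ => c := funext fun x => polyFun_C c x
    have h2 : polyGrad (MvPolynomial.C c) x = 0 := by
      ext i; simp [polyGrad_apply, polyFun_zero]
    rw [h1, h2]
    exact hasGradientAt_const x c
  | add p q hp hq =>
    have h1 : polyFun (p + q) = fun x => polyFun p x + polyFun q x :=
      funext fun x => polyFun_add p q x
    have h2 : polyGrad (p + q) x = polyGrad p x + polyGrad q x := by
      ext i; simp [polyGrad_apply, polyFun_add]
    rw [h1, h2, hasGradientAt_iff_hasFDerivAt, map_add]
    exact hp.hasFDerivAt.add hq.hasFDerivAt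
  | mul_X p n hp =>
    have h1 : polyFun (p * MvPolynomial.X n) = fun x => polyFun p x * x n :=
      funext fun x => by simp [polyFun]
    rw [h1, hasGradientAt_iff_hasFDerivAt]
    have hX : HasFDerivAt (fun x : Plane => x n) (EuclideanSpace.proj n : Plane →L[ℝ] ℝ) x :=
      (EuclideanSpace.proj n : Plane →L[ℝ] ℝ).hasFDerivAt
    refine (hp.hasFDerivAt.mul hX).congr_fderiv ?_
    ext w
    fin_cases n <;>
    simp [polyGrad_apply, MvPolynomial.pderiv_X, inner_plane, polyFun] <;> ring

lemma contDiff_polyFun (p : MvPolynomial (Fin 2) ℝ) {n : WithTop ℕ∞} : ContDiff ℝ n (polyFun p) := by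
  induction p using MvPolynomial.induction_on with
  | C c =>
    rw [show polyFun (MvPolynomial.C c) = fun _ => c from funext fun x => polyFun_C c x]
    exact contDiff_const
  | add p q hp hq =>
    rw [show polyFun (p + q) = fun x => polyFun p x + polyFun q x from
      funext fun x => polyFun_add p q x]
    exact hp.add hq
  | mul_X p n hp =>
    rw [show polyFun (p * MvPolynomial.X n) = fun x => polyFun p x * x n from
      funext fun x => by simp [polyFun]]
    exact hp.mul (EuclideanSpace.proj n : Plane →L[ℝ] ℝ).contDiff

lemma fderiv_polyFun (p : MvPolynomial (Fin 2) ℝ) (x w : Plane) :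
    fderiv ℝ (polyFun p) x w = inner ℝ (polyGrad p x) w := by
  rw [(hasGradientAt_polyFun p x).hasFDerivAt.fderiv]
  rfl

lemma gradDot_eq_inner (p q : MvPolynomial (Fin 2) ℝ) (x : Plane) :
    gradDot p q x = inner ℝ (polyGrad p x) (polyGrad q x) := by
  rw [inner_plane, gradDot, Fin.sum_univ_two]; rfl

lemma mem_Poly {p : MvPolynomial (Fin 2) ℝ} {m : ℕ} : p ∈ Poly m ↔ p.totalDegree ≤ m :=
  MvPolynomial.mem_restrictTotalDegree _ _ _

lemma mul_mem_Poly {p q : MvPolynomial (Fin 2) ℝ} {m n : ℕ} (hp : p ∈ Poly m) (hq : q ∈ Poly n) :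
    p * q ∈ Poly (m + n) :=
  mem_Poly.2 ((MvPolynomial.totalDegree_mul p q).trans
    (add_le_add (mem_Poly.1 hp) (mem_Poly.1 hq)))

lemma C_mul_mem_Poly {p : MvPolynomial (Fin 2) ℝ} {m : ℕ} (c : ℝ) (hp : p ∈ Poly m) :
    MvPolynomial.C c * p ∈ Poly m := by
  rw [← MvPolynomial.smul_eq_C_mul]
  exact Submodule.smul_mem _ c hp

lemma prod_mem_Poly {ι : Type*} (s : Finset ι) {f : ι → MvPolynomial (Fin 2) ℝ}
    (hf : ∀ i ∈ s, f i ∈ Poly 1) : ∏ i ∈ s, f i ∈ Poly s.card := by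
  refine mem_Poly.2 ((MvPolynomial.totalDegree_finsetProd s f).trans ?_)
  simpa using Finset.sum_le_card_nsmul s _ 1 fun i hi => mem_Poly.1 (hf i hi)

lemma pderiv_mem_Poly {p : MvPolynomial (Fin 2) ℝ} {m : ℕ} (hp : p ∈ Poly (m + 1)) (i : Fin 2) :
    MvPolynomial.pderiv i p ∈ Poly m := by
  rw [mem_Poly] at hp ⊢
  rw [p.as_sum, map_sum]
  refine MvPolynomial.totalDegree_finsetSum_le fun s hs => ?_
  rw [MvPolynomial.pderiv_monomial]
  -- When `s i = 0`, truncated subtraction would not lower the degree, but the coefficient is zero.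
  by_cases h0 : s i = 0
  · simp [h0]
  · refine (MvPolynomial.totalDegree_monomial_le _ _).trans ?_
    have h1 := (MvPolynomial.le_totalDegree hs).trans hp
    rw [Finsupp.sum_fintype _ _ (by simp)] at h1 ⊢
    simp only [Fin.sum_univ_two, id] at h1 ⊢
    fin_cases i <;> simp at h0 ⊢ <;> omega

/-- The Laplacian of a polynomial. -/
noncomputable def polyLap (p : MvPolynomial (Fin 2) ℝ) : MvPolynomial (Fin 2) ℝ :=
  ∑ i, MvPolynomial.pderiv i (MvPolynomial.pderiv i p)

/-- The derivative of a polynomial in the direction `n`. -/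
noncomputable def polyDeriv (n : Plane) (p : MvPolynomial (Fin 2) ℝ) : MvPolynomial (Fin 2) ℝ :=
  ∑ i, MvPolynomial.C (n i) * MvPolynomial.pderiv i p

lemma polyFun_polyDeriv (n : Plane) (p : MvPolynomial (Fin 2) ℝ) (x : Plane) :
    polyFun (polyDeriv n p) x = inner ℝ (polyGrad p x) n := by
  simp only [polyDeriv, Fin.sum_univ_two, polyFun_add, polyFun_mul, polyFun_C, inner_plane,
    polyGrad_apply]
  ring

lemma polyLap_mem_Poly {p : MvPolynomial (Fin 2) ℝ} {m : ℕ} (hp : p ∈ Poly (m + 2)) :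
    polyLap p ∈ Poly m :=
  Submodule.sum_mem _ fun i _ => pderiv_mem_Poly (pderiv_mem_Poly hp i) i

lemma polyDeriv_mem_Poly (n : Plane) {p : MvPolynomial (Fin 2) ℝ} {m : ℕ} (hp : p ∈ Poly (m + 1)) :
    polyDeriv n p ∈ Poly m :=
  Submodule.sum_mem _ fun i _ => C_mul_mem_Poly _ (pderiv_mem_Poly hp i)

/-! ### Green's formula on a triangle -/

lemma integrableOn_edge_of_continuous {e : Finset Plane} (he : e.card = 2) {F : Plane → ℝ}
    (hF : Continuous F) : IntegrableOn F (hull e) (μH[1] : Measure Plane) := by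
  have hfin : IsFiniteMeasure ((μH[1] : Measure Plane).restrict (hull e)) :=
    ⟨by simpa using hausdorff_hull_lt_top he⟩
  have : IntegrableOn (fun _ => (1 : ℝ)) (hull e) (μH[1] : Measure Plane) := integrable_const 1
  simpa using this.mul_continuousOn hF.continuousOn (isCompact_hull e)

/-- Green's formula. -/
lemma integral_inner_polyGrad {T : Triangulation Ω} {K : Finset Plane} (hK : K ∈ T.triangles)
    (p : MvPolynomial (Fin 2) ℝ) {φ : Plane → ℝ} (hφ : ContDiff ℝ 1 φ) :
    ∫ x in hull K, fderiv ℝ φ x (polyGrad p x) =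
      (∑ e ∈ edgesOf K, ∫ x in hull e,
        φ x * polyFun (polyDeriv (outwardNormal K e) p) x ∂(μH[1] : Measure Plane)) -
      ∫ x in hull K, φ x * polyFun (polyLap p) x := by
  set b : Fin 2 → Plane := fun i => EuclideanSpace.single i 1 with hb
  -- The divergence theorem is applied to the field `φ ∇p`, one component at a time.
  have hG : ∀ i, ContDiff ℝ 1 fun x => φ x * polyFun (MvPolynomial.pderiv i p) x := fun i =>
    hφ.mul (contDiff_polyFun _)
  have h1 := fun i => integral_fderiv_eq_sum_edges hK (hG i) (b i)
  have hfd : ∀ i x, fderiv ℝ (fun x => φ x * polyFun (MvPolynomial.pderiv i p) x) x (b i) =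
      polyGrad p x i * fderiv ℝ φ x (b i) +
        φ x * polyFun (MvPolynomial.pderiv i (MvPolynomial.pderiv i p)) x := by
    intro i x
    rw [fderiv_fun_mul (hφ.differentiable one_ne_zero x)
      ((contDiff_polyFun (n := 1) _).differentiable one_ne_zero x)]
    simp only [add_apply, smul_apply, smul_eq_mul,
      fderiv_polyFun]
    rw [hb, EuclideanSpace.inner_single_right]
    simp [polyGrad_apply]
    ring
  have hcd : ∀ i, Continuous fun x => fderiv ℝ φ x (b i) := fun i =>
    (hφ.continuous_fderiv one_ne_zero).clm_apply continuous_const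
  have hgc : ∀ i, Continuous fun x => polyGrad p x i := fun i => continuous_polyFun _
  have c1 : ∀ i, Continuous fun x => polyGrad p x i * fderiv ℝ φ x (b i) := fun i =>
    (hgc i).mul (hcd i)
  have c2 : ∀ q, Continuous fun x => φ x * polyFun q x := fun q =>
    hφ.continuous.mul (continuous_polyFun q)
  have hsum : ∀ x, fderiv ℝ φ x (polyGrad p x) = ∑ i, polyGrad p x i * fderiv ℝ φ x (b i) := by
    intro x
    have : polyGrad p x = ∑ i, polyGrad p x i • b i := by
      ext j
      fin_cases j <;> simp [hb, Fin.sum_univ_two]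
    conv_lhs => rw [this, map_sum]
    simp
  have h2 : ∀ i, ∫ x in hull K, polyGrad p x i * fderiv ℝ φ x (b i) =
      (∑ e ∈ edgesOf K, inner ℝ (b i) (outwardNormal K e) *
        ∫ x in hull e, φ x * polyFun (MvPolynomial.pderiv i p) x ∂(μH[1] : Measure Plane)) -
      ∫ x in hull K, φ x * polyFun (MvPolynomial.pderiv i (MvPolynomial.pderiv i p)) x := by
    intro i
    rw [← h1 i]
    simp only [hfd]
    rw [integral_add (integrableOn_hull (c1 i) K)
      (integrableOn_hull (c2 _) K), add_sub_cancel_right]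
  simp only [hsum]
  rw [integral_finsetSum _ fun i _ => integrableOn_hull (c1 i) K]
  simp only [h2, Finset.sum_sub_distrib, polyLap, polyFun_sum, Finset.mul_sum]
  rw [integral_finsetSum _ fun i _ =>
    integrableOn_hull (c2 _) K]
  congr 1
  rw [Finset.sum_comm]
  refine Finset.sum_congr rfl fun e he => ?_
  have hec : e.card = 2 := (Finset.mem_powersetCard.1 he).2
  simp only [polyDeriv, polyFun_sum, polyFun_mul, polyFun_C, Finset.mul_sum]
  have c3 : ∀ i, Continuous fun x => φ x * (outwardNormal K e i *
      polyFun (MvPolynomial.pderiv i p) x) := fun i =>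
    hφ.continuous.mul (continuous_const.mul (continuous_polyFun _))
  rw [integral_finsetSum _ fun i _ => integrableOn_edge_of_continuous hec (c3 i)]
  refine Finset.sum_congr rfl fun i _ => ?_
  simp only [mul_left_comm (φ _), integral_const_mul]
  rw [hb, EuclideanSpace.inner_single_left]
  simp

/-! ### Bubble functions -/

/-- An affine polynomial vanishing on the side `e` of `K` and positive on the rest of `K`. -/
lemma exists_edge_function {T : Triangulation Ω} {K e : Finset Plane} (hK : K ∈ T.triangles)
    (he : e ∈ edgesOf K) :
    ∃ l ∈ Poly 1, (∀ x ∈ hull e, polyFun l x = 0) ∧ (∀ x ∈ hull K, 0 ≤ polyFun l x) ∧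
      (∀ z ∈ K, z ∉ e → 0 < polyFun l z) ∧
      ∀ x y : Plane, ∀ s t : ℝ, s + t = 1 →
        polyFun l (s • x + t • y) = s * polyFun l x + t * polyFun l y := by
  obtain ⟨-, h0, hneg⟩ := outwardNormal_spec hK he
  have hec := (Finset.mem_powersetCard.1 he).2
  obtain ⟨a, ha⟩ : e.Nonempty := Finset.card_pos.1 (by omega)
  set N := outwardNormal K e
  -- This is `l x = n · (a - x)`, the distance to the line through `e`, signed to be positive on the
  -- inner side.
  set l : MvPolynomial (Fin 2) ℝ :=
    ∑ i, MvPolynomial.C (N i) * (MvPolynomial.C (a i) - MvPolynomial.X i)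
  have hl : ∀ x, polyFun l x = inner ℝ N (a - x) := fun x => by
    simp only [l, inner_plane,
      Fin.sum_univ_two, polyFun, map_add, map_mul, map_sub, MvPolynomial.eval_C,
      MvPolynomial.eval_X, PiLp.sub_apply]
  have haff : ∀ x y : Plane, ∀ s t : ℝ, s + t = 1 →
      polyFun l (s • x + t • y) = s * polyFun l x + t * polyFun l y := fun x y s t hst => by
    obtain rfl : s = 1 - t := by linarith
    rw [hl, hl, hl, inner_plane, inner_plane, inner_plane]
    simp
    ring
  have hv0 : ∀ x ∈ e, polyFun l x = 0 := fun x hx => by rw [hl]; exact h0 x hx a ha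
  have hvpos : ∀ z ∈ K, z ∉ e → 0 < polyFun l z := fun z hz hze => by
    rw [hl, ← neg_sub, inner_neg_right]
    linarith [hneg a ha z hz hze]
  refine ⟨l, ?_, ?_, ?_, hvpos, haff⟩
  · refine Submodule.sum_mem _ fun i _ => C_mul_mem_Poly _ (mem_Poly.2 ?_)
    refine (MvPolynomial.totalDegree_sub _ _).trans ?_
    simp
  · refine fun x hx => convexHull_min (s := (e : Set Plane)) (t := {x | polyFun l x = 0}) hv0
      ?_ hx
    intro x hx y hy s t _ _ hst
    have hx : polyFun l x = 0 := hx
    have hy : polyFun l y = 0 := hy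
    change polyFun l (s • x + t • y) = 0
    rw [haff _ _ _ _ hst, hx, hy]; simp
  · refine fun x hx => convexHull_min (s := (K : Set Plane)) (t := {x | 0 ≤ polyFun l x})
      (fun z hz => ?_) ?_ hx
    · by_cases hze : z ∈ e
      · exact (hv0 z hze).ge
      · exact (hvpos z hz hze).le
    · intro x hx y hy s t hs ht hst
      have hx : 0 ≤ polyFun l x := hx
      have hy : 0 ≤ polyFun l y := hy
      change 0 ≤ polyFun l (s • x + t • y)
      rw [haff _ _ _ _ hst]
      positivity

lemma hull_subset_of_mem_edgesOf {K e : Finset Plane} (he : e ∈ edgesOf K) : hull e ⊆ hull K :=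
  convexHull_mono (Finset.coe_subset.2 (Finset.mem_powersetCard.1 he).1)

lemma eq_zero_of_setIntegral_segment {a b : Plane} (hab : a ≠ b)
    {F : Plane → ℝ} (hF : Continuous F) (h0 : ∀ y ∈ segment ℝ a b, 0 ≤ F y)
    (hi : ∫ y in segment ℝ a b, F y ∂(μH[1] : Measure Plane) = 0) {x : Plane}
    (hx : x ∈ segment ℝ a b) : F x = 0 := by
  by_contra h
  exact (setIntegral_edge_pos hab hx hF h0 ((h0 x hx).lt_of_ne' h)).ne' hi

/-- A polynomial whose `L²(K)` products with polynomials of degree at most `m + 3` agree with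
boundary integrals of polynomials of degree at most `m + 1` vanishes, and so do the
polynomials on the boundary. -/
lemma eq_zero_of_bubble {T : Triangulation Ω} {K : Finset Plane} (hK : K ∈ T.triangles) {m : ℕ}
    {d : MvPolynomial (Fin 2) ℝ} (hd : d ∈ Poly m)
    {r : Finset Plane → MvPolynomial (Fin 2) ℝ} (hr : ∀ e ∈ edgesOf K, r e ∈ Poly (m + 1))
    (h : ∀ φ ∈ Poly (m + 3), ∫ x in hull K, polyFun φ x * polyFun d x =
      ∑ e ∈ edgesOf K, ∫ x in hull e, polyFun φ x * polyFun (r e) x ∂(μH[1] : Measure Plane)) :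
    d = 0 ∧ ∀ e ∈ edgesOf K, ∀ x ∈ hull e, polyFun (r e) x = 0 := by
  classical
  choose! l hl1 hl0 hlK hlpos hlaff using fun e (he : e ∈ edgesOf K) =>
    exists_edge_function hK he
  have hKc := (T.mem_triangles.1 hK).2
  have hEc : (edgesOf K).card = 3 := by simp [edgesOf, Finset.card_powersetCard, hKc]
  have hlne : ∀ e ∈ edgesOf K, l e ≠ 0 := by
    intro e he h0
    obtain ⟨heK, hec⟩ := Finset.mem_powersetCard.1 he
    obtain ⟨z, hz, hze⟩ := Finset.exists_mem_notMem_of_card_lt_card (by omega : e.card < K.card)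
    have := hlpos e he z hz hze
    rw [h0, polyFun_zero] at this
    exact this.false
  have hd0 : d = 0 := by
    -- The cubic bubble vanishes on `∂K` and is nonnegative on `K`. Testing with `B * d`, of degree
    -- `m + 3`, gives `∫ B d² = 0`, hence `B * d * d = 0` as polynomials, and `B ≠ 0` can be
    -- cancelled.
    set B := ∏ e ∈ edgesOf K, l e with hB
    have hB0 : B ≠ 0 := Finset.prod_ne_zero_iff.2 hlne
    have hBd : B * d ∈ Poly (m + 3) := by
      have := mul_mem_Poly (prod_mem_Poly (edgesOf K) hl1) hd
      rwa [hEc, add_comm] at this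
    have h1 := h _ hBd
    rw [Finset.sum_eq_zero] at h1
    · have h2 : ∀ᵐ x ∂volume.restrict (hull K), 0 ≤ polyFun (B * d) x * polyFun d x := by
        refine (ae_restrict_iff' (isCompact_hull K).measurableSet).2 (.of_forall fun x hx => ?_)
        rw [polyFun_mul, mul_assoc, hB, polyFun_prod]
        exact mul_nonneg (Finset.prod_nonneg fun e he => hlK e he x hx) (mul_self_nonneg _)
      have h3 := (integral_eq_zero_iff_of_nonneg_ae h2 (integrableOn_polyFun_mul _ _ K)).1 h1
      have h4 : B * d * d = 0 := by
        refine eq_of_ae_eq (T.interior_nonempty hK) ?_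
        filter_upwards [h3] with x hx
        rw [polyFun_mul, hx, polyFun_zero]
        rfl
      simpa [hB0] using h4
    · intro e he
      refine setIntegral_eq_zero_of_forall_eq_zero fun x hx => ?_
      rw [polyFun_mul, hB, polyFun_prod, Finset.prod_eq_zero he (hl0 e he x hx), zero_mul,
        zero_mul]
  refine ⟨hd0, fun e he => ?_⟩
  obtain ⟨heK, hec⟩ := Finset.mem_powersetCard.1 he
  obtain ⟨a, b, hab, rfl⟩ := Finset.card_eq_two.1 hec
  set e : Finset Plane := {a, b} with hedef
  -- Without the factor of `e`, the product is quadratic and still vanishes on the two other sides.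
  -- The test polynomial `B * r e` has degree at most `2 + (m + 1)` and leaves `∫_e B r_e² = 0`.
  set B := ∏ e' ∈ (edgesOf K).erase e, l e' with hB
  have hBr : B * r e ∈ Poly (m + 3) := by
    have := mul_mem_Poly (prod_mem_Poly ((edgesOf K).erase e)
      fun e' he' => hl1 e' (Finset.mem_of_mem_erase he')) (hr e he)
    rw [Finset.card_erase_of_mem he, hEc] at this
    rwa [show m + 3 = 3 - 1 + (m + 1) by omega]
  have h1 := h _ hBr
  rw [hd0, ← Finset.add_sum_erase _ _ he, Finset.sum_eq_zero, add_zero] at h1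
  · simp only [polyFun_zero, mul_zero, integral_zero] at h1
    rw [hedef, hull_pair, ← hedef] at h1 ⊢
    have hseg : segment ℝ a b ⊆ hull K := by
      rw [← hull_pair, ← hedef]
      exact hull_subset_of_mem_edgesOf he
    -- `B` vanishes at the endpoints of `e`, so only the open edge is treated; continuity supplies
    -- the endpoints. Inside, each factor `l e'` is positive because one of `a`, `b` lies off `e'`.
    have h2 : ∀ x ∈ openSegment ℝ a b, polyFun (r e) x = 0 := by
      intro x hx
      have h3 := eq_zero_of_setIntegral_segment hab
        (F := fun y => polyFun (B * r e) y * polyFun (r e) y)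
        ((continuous_polyFun (B * r e)).mul (continuous_polyFun (r e))) (fun y hy => by
          rw [polyFun_mul, mul_assoc, hB, polyFun_prod]
          exact mul_nonneg (Finset.prod_nonneg fun e' he' =>
            hlK e' (Finset.mem_of_mem_erase he') y (hseg hy)) (mul_self_nonneg _))
        h1.symm (openSegment_subset_segment ℝ a b hx)
      have h4 : 0 < polyFun B x := by
        rw [hB, polyFun_prod]
        refine Finset.prod_pos fun e' he' => ?_
        obtain ⟨hne, he'E⟩ := Finset.mem_erase.1 he'
        have he'c := (Finset.mem_powersetCard.1 he'E).2
        obtain ⟨s, t, hs, ht, hst, rfl⟩ := hx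
        rw [hlaff e' he'E a b s t hst]
        have ha : a ∈ K := heK (by simp [hedef])
        have hb : b ∈ K := heK (by simp [hedef])
        have ha0 := hlK e' he'E a (subset_convexHull ℝ _ ha)
        have hb0 := hlK e' he'E b (subset_convexHull ℝ _ hb)
        by_cases hae : a ∈ e'
        · by_cases hbe : b ∈ e'
          · refine absurd (Finset.eq_of_subset_of_card_le ?_ ?_).symm hne
            · intro z hz
              simp only [hedef, Finset.mem_insert, Finset.mem_singleton] at hz
              rcases hz with rfl | rfl <;> assumption
            · rw [hec, he'c]
          · have := hlpos e' he'E b hb hbe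
            positivity
        · have := hlpos e' he'E a ha hae
          positivity
      rw [polyFun_mul, mul_assoc] at h3
      exact mul_self_eq_zero.1 ((mul_eq_zero.1 h3).resolve_left h4.ne')
    have hcl : IsClosed {x | polyFun (r e) x = 0} :=
      isClosed_eq (continuous_polyFun _) continuous_const
    intro x hx
    exact closure_minimal (s := openSegment ℝ a b) h2 hcl ((closure_openSegment (𝕜 := ℝ) a b).symm ▸ hx)
  · intro e' he'
    obtain ⟨hne, he'E⟩ := Finset.mem_erase.1 he'
    refine setIntegral_eq_zero_of_forall_eq_zero fun x hx => ?_
    rw [polyFun_mul, hB, polyFun_prod,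
      Finset.prod_eq_zero he' (hl0 e' he'E x hx), zero_mul, zero_mul]

/-! ### Functions with vanishing weak Laplacian -/

lemma isWeakLaplacian_weakLaplacian {T : Triangulation Ω} {K : Finset Plane}
    (hK : K ∈ T.triangles) (ν : Finset Plane → Plane) (m : ℕ) (v : L2 Ω × T.EdgeL2) :
    IsWeakLaplacian T ν m v K (weakLaplacian T ν m v K) :=
  Classical.epsilon_spec (existsUnique_weakLaplacian hK ν m v).exists

/-- If the weak Laplacian vanishes on `K`, then `vₙ nₑ · n` is the normal derivative of `v₀`
and `v₀` is harmonic in `K`. -/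
lemma harmonic_of_weakLaplacian_eq_zero {T : Triangulation Ω} {K : Finset Plane}
    (hK : K ∈ T.triangles) {ν : Finset Plane → Plane} {k : ℕ} {v : L2 Ω × T.EdgeL2}
    (hv : v ∈ Vh T k) (h0 : weakLaplacian T ν (k + 3) v K = 0) :
    polyLap (localPoly v.1 K) = 0 ∧ ∀ e ∈ edgesOf K,
      ∀ᵐ x ∂(μH[1] : Measure Plane).restrict (hull e),
        v.2 x * inner ℝ (ν e) (outwardNormal K e) =
          polyFun (polyDeriv (outwardNormal K e) (localPoly v.1 K)) x := by
  obtain ⟨p0, hp, hp0⟩ := hv.1.2 K hK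
  obtain rfl := localPoly_eq hK hp0
  set p := localPoly v.1 K
  choose! q hq hqe using fun e (he : e ∈ edgesOf K) => hv.2 e (T.edgesOf_subset hK he)
  set r : Finset Plane → MvPolynomial (Fin 2) ℝ := fun e =>
    polyDeriv (outwardNormal K e) p -
      MvPolynomial.C (inner ℝ (ν e) (outwardNormal K e)) * q e with hrdef
  have hr : ∀ e ∈ edgesOf K, r e ∈ Poly (k + 1) := fun e he =>
    Submodule.sub_mem _ (polyDeriv_mem_Poly _ hp) (C_mul_mem_Poly _ (hq e he))
  -- Subtracting the definition of the zero weak Laplacian from Green's formula leaves `Δp` in the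
  -- interior and the defect `r e` on the sides.
  obtain ⟨hA, hB⟩ := eq_zero_of_bubble hK (polyLap_mem_Poly hp) hr fun φ hφ => by
    have h1 := (isWeakLaplacian_weakLaplacian hK ν (k + 3) v).2 φ hφ
    rw [h0] at h1
    simp only [polyFun_zero, zero_mul, integral_zero, weakLaplacianRhs, gradDot_eq_inner] at h1
    have h2 := integral_inner_polyGrad hK p (contDiff_polyFun φ (n := 1))
    simp only [fderiv_polyFun] at h2
    have h3 : ∀ e ∈ edgesOf K, ∫ x in hull e,
        v.2 x * inner ℝ (ν e) (outwardNormal K e) * polyFun φ x ∂(μH[1] : Measure Plane) =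
        (∫ x in hull e, polyFun φ x * polyFun (polyDeriv (outwardNormal K e) p) x
          ∂(μH[1] : Measure Plane)) -
        ∫ x in hull e, polyFun φ x * polyFun (r e) x ∂(μH[1] : Measure Plane) := fun e he => by
      have hec := (Finset.mem_powersetCard.1 he).2
      have hc : ∀ q, Continuous fun x => polyFun φ x * polyFun q x := fun q =>
        (continuous_polyFun φ).mul (continuous_polyFun q)
      rw [← integral_sub (integrableOn_edge_of_continuous hec (hc _))
        (integrableOn_edge_of_continuous hec (hc _))]
      refine integral_congr_ae ?_
      filter_upwards [hqe e he] with x hx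
      rw [hx, hrdef, polyFun_sub, polyFun_mul, polyFun_C]
      ring
    rw [Finset.sum_congr rfl h3, Finset.sum_sub_distrib] at h1
    simp only [real_inner_comm] at h1
    linarith
  refine ⟨hA, fun e he => ?_⟩
  filter_upwards [hqe e he, ae_restrict_mem (isCompact_hull e).measurableSet] with x hx hxe
  have := hB e he x hxe
  rw [hrdef, polyFun_sub, polyFun_mul, polyFun_C] at this
  rw [hx]
  linarith

/-- A function with vanishing weak Laplacian is weakly harmonic across the edges. -/
lemma sum_integral_polyGrad_eq_zero {T : Triangulation Ω} (hΩ : IsOpen Ω)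
    {ν : Finset Plane → Plane} {k : ℕ} {v : L2 Ω × T.EdgeL2} (hv : v ∈ Vh T k)
    (h0 : ∀ K ∈ T.triangles, weakLaplacian T ν (k + 3) v K = 0) {φ : Plane → ℝ}
    (hφ : ContDiff ℝ 1 φ) (hs : tsupport φ ⊆ Ω) :
    ∑ K ∈ T.triangles, ∫ x in hull K, fderiv ℝ φ x (polyGrad (localPoly v.1 K) x) = 0 := by
  have h1 : ∀ K ∈ T.triangles,
      ∫ x in hull K, fderiv ℝ φ x (polyGrad (localPoly v.1 K) x) =
      ∑ e ∈ edgesOf K, inner ℝ (ν e) (outwardNormal K e) *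
        ∫ x in hull e, φ x * v.2 x ∂(μH[1] : Measure Plane) := by
    intro K hK
    obtain ⟨hA, hB⟩ := harmonic_of_weakLaplacian_eq_zero hK hv (h0 K hK)
    rw [integral_inner_polyGrad hK _ hφ, hA]
    simp only [polyFun_zero, mul_zero, integral_zero, sub_zero]
    refine Finset.sum_congr rfl fun e he => ?_
    rw [← integral_const_mul]
    refine integral_congr_ae ?_
    filter_upwards [hB e he] with x hx
    rw [← hx]
    ring
  rw [Finset.sum_congr rfl h1, sum_triangles_edgesOf]
  refine Finset.sum_eq_zero fun e he => ?_
  -- The edge integral does not depend on the triangle, so the normals add up to `normalJump`. On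
  -- boundary edges it is `φ` that vanishes.
  rw [← Finset.sum_mul, ← inner_sum]
  change inner ℝ (ν e) (normalJump T e) * _ = 0
  by_cases hfr : hull e ⊆ frontier Ω
  · rw [setIntegral_eq_zero_of_forall_eq_zero, mul_zero]
    intro x hx
    have : φ x = 0 := by
      by_contra h
      have hxΩ := hs (subset_tsupport φ h)
      have := hfr hx
      rw [hΩ.frontier_eq] at this
      exact this.2 hxΩ
    rw [this, zero_mul]
  · rw [normalJump_eq_zero T hΩ he hfr, inner_zero_right, zero_mul]

/-! ### Convergence in `L²` -/

section L2

variable {α E : Type*} [MeasurableSpace α] {μ : Measure α} [NormedAddCommGroup E]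

lemma tendsto_toLp {F : ℕ → α → E} {f : α → E} (hF : ∀ n, MemLp (F n) 2 μ) (hf : MemLp f 2 μ)
    (ht : Tendsto (fun n => eLpNorm (fun x => F n x - f x) 2 μ) atTop (𝓝 0)) :
    Tendsto (fun n => (hF n).toLp (F n)) atTop (𝓝 (hf.toLp f)) :=
  (Lp.tendsto_Lp_iff_tendsto_eLpNorm'' F hF f hf).2 ht

/-- Continuity of the `L²` inner product, for values in `E` so that it serves both functions and
gradients. -/
lemma tendsto_integral_inner [InnerProductSpace ℝ E] {F : ℕ → α → E} {f h : α → E}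
    (hF : ∀ n, MemLp (F n) 2 μ) (hf : MemLp f 2 μ) (hh : MemLp h 2 μ)
    (ht : Tendsto (fun n => eLpNorm (fun x => F n x - f x) 2 μ) atTop (𝓝 0)) :
    Tendsto (fun n => ∫ x, inner ℝ (F n x) (h x) ∂μ) atTop (𝓝 (∫ x, inner ℝ (f x) (h x) ∂μ)) := by
  have key : ∀ {f : α → E} (hf : MemLp f 2 μ),
      ∫ x, inner ℝ (f x) (h x) ∂μ = inner ℝ (hf.toLp f) (hh.toLp h) := fun hf => by
    rw [L2.inner_def]
    refine integral_congr_ae ?_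
    filter_upwards [hf.coeFn_toLp, hh.coeFn_toLp] with x h1 h2
    rw [h1, h2]
  simp only [fun n => key (hF n), key hf]
  exact ((tendsto_toLp hF hf ht).inner tendsto_const_nhds)

end L2

/-! ### Test functions -/

lemma continuous_gradient {φ : Plane → ℝ} (hφ : ContDiff ℝ ∞ φ) : Continuous (gradient φ) :=
  (InnerProductSpace.toDual ℝ Plane).symm.continuous.comp (hφ.continuous_fderiv (by simp))

lemma hasCompactSupport_gradient {φ : Plane → ℝ} (hc : HasCompactSupport φ) :
    HasCompactSupport (gradient φ) :=
  (hc.fderiv (𝕜 := ℝ)).comp_left (g := (InnerProductSpace.toDual ℝ Plane).symm) (map_zero _)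

lemma memLp_testFunction {φ : Plane → ℝ} (hφ : ContDiff ℝ ∞ φ) (hc : HasCompactSupport φ) :
    MemLp φ 2 (volume.restrict Ω) :=
  (hφ.continuous.memLp_of_hasCompactSupport hc).restrict _

lemma memLp_gradient {φ : Plane → ℝ} (hφ : ContDiff ℝ ∞ φ) (hc : HasCompactSupport φ) :
    MemLp (gradient φ) 2 (volume.restrict Ω) :=
  ((continuous_gradient hφ).memLp_of_hasCompactSupport (hasCompactSupport_gradient hc)).restrict _

lemma inner_gradient_eq (φ : Plane → ℝ) (x w : Plane) :
    inner ℝ (gradient φ x) w = fderiv ℝ φ x w := inner_gradient_left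

/-- Integration by parts against a test function. -/
lemma integral_fderiv_mul_testFunction {φ ψ : Plane → ℝ} (hφ : ContDiff ℝ ∞ φ)
    (hψ : ContDiff ℝ ∞ ψ) (hψc : HasCompactSupport ψ) (hψs : tsupport ψ ⊆ Ω) (w : Plane) :
    ∫ x in Ω, fderiv ℝ φ x w * ψ x = -∫ x in Ω, φ x * fderiv ℝ ψ x w := by
  have hne : (∞ : WithTop ℕ∞) ≠ 0 := by simp
  have c1 : Continuous fun x => fderiv ℝ φ x w :=
    (hφ.continuous_fderiv hne).clm_apply continuous_const
  have c2 : Continuous fun x => fderiv ℝ ψ x w :=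
    (hψ.continuous_fderiv hne).clm_apply continuous_const
  rw [setIntegral_eq_integral_of_forall_compl_eq_zero,
    setIntegral_eq_integral_of_forall_compl_eq_zero,
    integral_mul_fderiv_eq_neg_fderiv_mul_of_integrable (μ := (volume : Measure Plane)), neg_neg]
  · exact (c1.mul hψ.continuous).integrable_of_hasCompactSupport hψc.mul_left
  · exact (hφ.continuous.mul c2).integrable_of_hasCompactSupport
      ((hψc.fderiv_apply (𝕜 := ℝ) w).mul_left)
  · exact (hφ.continuous.mul hψ.continuous).integrable_of_hasCompactSupport hψc.mul_left
  · exact fun x _ => hφ.differentiable hne x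
  · exact fun x _ => hψ.differentiable hne x
  · intro x hx
    have : fderiv ℝ ψ x = 0 := by
      by_contra h
      exact hx (hψs (support_fderiv_subset ℝ h))
    simp [this]
  · intro x hx
    have : ψ x = 0 := by
      by_contra h
      exact hx (hψs (subset_tsupport ψ h))
    simp [this]

/-- On a triangle on which a function of `H¹₀(Ω)` is a polynomial, the weak gradient is the
gradient of the polynomial. -/
lemma weakGradient_eq_polyGrad {T : Triangulation Ω} (hΩ : IsOpen Ω) {K : Finset Plane}
    (hK : K ∈ T.triangles) {v : L2 Ω} {p : MvPolynomial (Fin 2) ℝ} (hp : Represents p v K)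
    {g : Plane → Plane} {φ : ℕ → Plane → ℝ} (hg : MemLp g 2 (volume.restrict Ω))
    (hφ : ∀ n, ContDiff ℝ ∞ (φ n) ∧ HasCompactSupport (φ n) ∧ tsupport (φ n) ⊆ Ω)
    (h0 : Tendsto (fun n => eLpNorm (fun x => φ n x - v x) 2 (volume.restrict Ω)) atTop (𝓝 0))
    (h1 : Tendsto (fun n => eLpNorm (fun x => gradient (φ n) x - g x) 2 (volume.restrict Ω))
      atTop (𝓝 0)) :
    g =ᵐ[volume.restrict (hull K)] polyGrad p := by
  have hfin : IsFiniteMeasure (volume.restrict Ω : Measure Plane) :=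
    ⟨by simpa using (isBounded_of_triangulation T).measure_lt_top⟩
  set U := interior (hull K) ∩ Ω with hU
  have hUo : IsOpen U := isOpen_interior.inter hΩ
  have hgi : Integrable g (volume.restrict Ω) := hg.integrable (by norm_num)
  -- The derivative is moved from `φ n` to `ψ`, the limit is taken, `v` is replaced by `p` on the
  -- support of `ψ`, and the derivative is moved back.
  have hkey : ∀ ψ : Plane → ℝ, ContDiff ℝ ∞ ψ → HasCompactSupport ψ → tsupport ψ ⊆ U → ∀ w,
      ∫ x in Ω, inner ℝ (g x) (ψ x • w) = ∫ x in Ω, inner ℝ (polyGrad p x) (ψ x • w) := by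
    intro ψ hψ hψc hψs w
    have hψΩ : tsupport ψ ⊆ Ω := hψs.trans Set.inter_subset_right
    have hψw : MemLp (fun x => ψ x • w) 2 (volume.restrict Ω) :=
      ((hψ.continuous.smul continuous_const).memLp_of_hasCompactSupport
        hψc.smul_right).restrict _
    have hdψ : MemLp (fun x => fderiv ℝ ψ x w) 2 (volume.restrict Ω) :=
      (((hψ.continuous_fderiv (by simp)).clm_apply continuous_const).memLp_of_hasCompactSupport
        (hψc.fderiv_apply (𝕜 := ℝ) w)).restrict _
    have t1 := tendsto_integral_inner (fun n => memLp_gradient (hφ n).1 (hφ n).2.1) hg hψw h1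
    have t2 := tendsto_integral_inner (fun n => memLp_testFunction (hφ n).1 (hφ n).2.1)
      (Lp.memLp v) hdψ h0
    have e1 : ∀ n, ∫ x in Ω, inner ℝ (gradient (φ n) x) (ψ x • w) =
        -∫ x in Ω, inner ℝ (φ n x) (fderiv ℝ ψ x w) := fun n => by
      simp only [real_inner_smul_right, inner_gradient_eq]
      simp only [mul_comm (ψ _)]
      rw [integral_fderiv_mul_testFunction (hφ n).1 hψ hψc hψΩ w]
      simp [mul_comm]
    simp only [e1] at t1
    have e2 := tendsto_nhds_unique t1 t2.neg
    have e3 : ∫ x in Ω, inner ℝ (v x) (fderiv ℝ ψ x w) =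
        ∫ x in Ω, polyFun p x * fderiv ℝ ψ x w := by
      refine integral_congr_ae ?_
      have h2 : ∀ᵐ x ∂volume.restrict Ω, x ∈ hull K → v x = polyFun p x := by
        have := (ae_restrict_iff' (isCompact_hull K).measurableSet).1 hp
        exact ae_restrict_of_ae this
      filter_upwards [h2] with x hx
      by_cases hxU : x ∈ U
      · rw [hx (interior_subset hxU.1)]
        simp [mul_comm]
      · have : fderiv ℝ ψ x = 0 := by
          by_contra h
          exact hxU (hψs (support_fderiv_subset ℝ h))
        simp [this]
    rw [e2, e3, ← integral_fderiv_mul_testFunction (contDiff_polyFun p) hψ hψc hψΩ w]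
    refine integral_congr_ae (.of_forall fun x => ?_)
    simp only [fderiv_polyFun, real_inner_smul_right, mul_comm]
  -- Fundamental lemma of the calculus of variations on `U`.
  have hae : ∀ᵐ x, x ∈ U → g x - polyGrad p x = 0 := by
    refine hUo.ae_eq_zero_of_integral_contDiff_smul_eq_zero ?_ ?_
    · refine LocallyIntegrableOn.sub ?_
        ((continuous_polyGrad p).locallyIntegrable.locallyIntegrableOn U)
      exact IntegrableOn.locallyIntegrableOn
        (hgi.mono_measure (Measure.restrict_mono Set.inter_subset_right le_rfl))
    · intro ψ hψ hψc hψs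
      have hψΩ : tsupport ψ ⊆ Ω := hψs.trans Set.inter_subset_right
      rw [← setIntegral_eq_integral_of_forall_compl_eq_zero (s := Ω)]
      · have i1 : Integrable (fun x => ψ x • g x) (volume.restrict Ω) := by
          obtain ⟨C, hC⟩ := hψc.exists_bound_of_continuous hψ.continuous
          exact hgi.bdd_smul C hψ.continuous.aestronglyMeasurable (.of_forall hC)
        have i2 : Integrable (fun x => ψ x • polyGrad p x) (volume.restrict Ω) :=
          ((hψ.continuous.smul (continuous_polyGrad p)).integrable_of_hasCompactSupport
            hψc.smul_right).integrableOn
        simp only [smul_sub]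
        rw [integral_sub i1 i2, sub_eq_zero]
        refine ext_inner_left ℝ fun w => ?_
        rw [← integral_inner i1, ← integral_inner i2]
        have := hkey ψ hψ hψc hψs w
        simp only [real_inner_smul_right, real_inner_comm] at this ⊢
        exact this
      · intro x hx
        have : ψ x = 0 := by
          by_contra h
          exact hx (hψΩ (subset_tsupport ψ h))
        simp [this]
  -- Passing from `K` to `U` loses only boundary points of the convex set `K` and of `Ω`, both null
  -- sets.
  have hnull : ∀ᵐ x ∂volume.restrict (hull K), x ∈ U := by
    have n1 : ∀ᵐ x : Plane, x ∉ frontier (hull K) :=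
      measure_eq_zero_iff_ae_notMem.1 ((convex_convexHull ℝ _).addHaar_frontier volume)
    have n2 : ∀ᵐ x : Plane, x ∉ frontier Ω :=
      measure_eq_zero_iff_ae_notMem.1 (volume_frontier_eq_zero T)
    filter_upwards [ae_restrict_of_ae n1, ae_restrict_of_ae n2,
      ae_restrict_mem (isCompact_hull K).measurableSet] with x hx1 hx2 hx
    refine ⟨?_, ?_⟩
    · by_contra h
      exact hx1 ⟨subset_closure hx, h⟩
    · by_contra h
      exact hx2 ⟨hull_subset_closure T hK hx, by rwa [hΩ.interior_eq]⟩
  filter_upwards [hnull, ae_restrict_of_ae hae] with x h2 h3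
  exact sub_eq_zero.1 (h3 h2)

/-- A function of `H¹₀(Ω)` with vanishing weak gradient is zero. -/
lemma eq_zero_of_weakGradient_eq_zero (hb : Bornology.IsBounded Ω) {v : L2 Ω}
    {g : Plane → Plane} {φ : ℕ → Plane → ℝ} (hg : g =ᵐ[volume.restrict Ω] 0)
    (hφ : ∀ n, ContDiff ℝ ∞ (φ n) ∧ HasCompactSupport (φ n) ∧ tsupport (φ n) ⊆ Ω)
    (h0 : Tendsto (fun n => eLpNorm (fun x => φ n x - v x) 2 (volume.restrict Ω)) atTop (𝓝 0))
    (h1 : Tendsto (fun n => eLpNorm (fun x => gradient (φ n) x - g x) 2 (volume.restrict Ω))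
      atTop (𝓝 0)) : v = 0 := by
  have hfin : IsFiniteMeasure (volume.restrict Ω : Measure Plane) :=
    ⟨by simpa using hb.measure_lt_top⟩
  have h2 : Tendsto (fun n => eLpNorm (gradient (φ n)) 2 (volume.restrict Ω)) atTop (𝓝 0) := by
    refine h1.congr fun n => eLpNorm_congr_ae ?_
    filter_upwards [hg] with x hx
    rw [hx]; simp
  -- Poincaré inequality in two steps. Gradient exponent `2` is critical in the plane, so the
  -- Sobolev inequality is used from `1` to `2`, with constant `C`; Hölder's inequality on the
  -- bounded set `Ω` then passes from the `L¹` to the `L²` norm of the gradient at the cost of `M`.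
  set C : ENNReal := ((eLpNormLESNormFDerivOfLeConst ℝ (volume : Measure Plane) Ω 1 2 : NNReal) :
    ENNReal) with hC
  set M : ENNReal := (volume.restrict Ω : Measure Plane) Set.univ ^ (1 / (1 : ENNReal).toReal -
    1 / (2 : ENNReal).toReal) with hM
  have hMfin : M ≠ ⊤ := ENNReal.rpow_ne_top_of_nonneg (by norm_num) (measure_ne_top _ _)
  have h3 : ∀ n, eLpNorm (fun x => φ n x - 0) 2 (volume.restrict Ω) ≤
      C * M * eLpNorm (gradient (φ n)) 2 (volume.restrict Ω) := by
    intro n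
    obtain ⟨hn, hnc, hns⟩ := hφ n
    have s1 := eLpNorm_le_eLpNorm_fderiv_of_le (volume : Measure Plane) (u := φ n) (s := Ω)
      (hn.of_le (by simp)) ((subset_tsupport _).trans hns) (p := 1) (q := 2) le_rfl
      (by simp) (by simp; norm_num) hb
    have s2 : eLpNorm (fderiv ℝ (φ n)) 1 volume = eLpNorm (gradient (φ n)) 1
        (volume.restrict Ω) := by
      rw [← eLpNorm_restrict_eq_of_support_subset (s := Ω) (f := fderiv ℝ (φ n))
        ((support_fderiv_subset ℝ).trans hns)]
      refine eLpNorm_congr_norm_ae (.of_forall fun x => ?_)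
      simp [gradient]
    have s3 := eLpNorm_le_eLpNorm_mul_rpow_measure_univ (p := 1) (q := 2)
      (μ := volume.restrict Ω) (f := gradient (φ n)) (by norm_num)
      (continuous_gradient hn).aestronglyMeasurable
    simp only [sub_zero]
    calc eLpNorm (φ n) 2 (volume.restrict Ω) ≤ eLpNorm (φ n) 2 volume :=
          eLpNorm_mono_measure _ Measure.restrict_le_self
      _ ≤ C * eLpNorm (fderiv ℝ (φ n)) 1 volume := by exact_mod_cast s1
      _ ≤ C * (eLpNorm (gradient (φ n)) 2 (volume.restrict Ω) * M) := by
          rw [s2]; gcongr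
      _ = _ := by ring
  have h4 : Tendsto (fun n => eLpNorm (fun x => φ n x - (fun _ => (0 : ℝ)) x) 2
      (volume.restrict Ω)) atTop (𝓝 0) := by
    have hlim : Tendsto (fun n => C * M * eLpNorm (gradient (φ n)) 2 (volume.restrict Ω))
        atTop (𝓝 0) := by
      have := ENNReal.Tendsto.const_mul (a := C * M) h2
        (Or.inr (ENNReal.mul_ne_top (by rw [hC]; exact ENNReal.coe_ne_top) hMfin))
      simpa using this
    exact tendsto_of_tendsto_of_tendsto_of_le_of_le tendsto_const_nhds hlim
      (fun _ => zero_le) h3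
  have hm := fun n => memLp_testFunction (Ω := Ω) (hφ n).1 (hφ n).2.1
  have := tendsto_nhds_unique (tendsto_toLp hm (Lp.memLp v) h0)
    (tendsto_toLp hm MemLp.zero' h4)
  rw [Lp.toLp_coeFn] at this
  rw [this]
  exact MemLp.toLp_zero _

/-! ### Definiteness of the scheme -/

/-- If the two unit normals were orthogonal, their determinant would be `±1` and they would span the
plane; being orthogonal to both, the edge vector would be zero. -/
lemma inner_outwardNormal_ne_zero {T : Triangulation Ω} {ν : Finset Plane → Plane}
    (hν : IsNormalChoice T ν) {K e : Finset Plane} (hK : K ∈ T.triangles) (he : e ∈ edgesOf K) :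
    inner ℝ (ν e) (outwardNormal K e) ≠ 0 := by
  obtain ⟨h1, h2⟩ := hν e (T.edgesOf_subset hK he)
  obtain ⟨n1, n2, -⟩ := outwardNormal_spec hK he
  obtain ⟨a, b, hab, rfl⟩ := Finset.card_eq_two.1 (Finset.mem_powersetCard.1 he).2
  have h2 := h2 a (by simp) b (by simp)
  have n2 := n2 a (by simp) b (by simp)
  set n := outwardNormal K {a, b}
  set m := ν {a, b}
  intro h0
  have hu : 0 < ‖b - a‖ ^ 2 := by
    have := norm_pos_iff.2 (sub_ne_zero.2 hab.symm)
    positivity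
  have hm2 : m 0 ^ 2 + m 1 ^ 2 = 1 := by rw [← norm_sq_plane, h1]; norm_num
  have hn2 : n 0 ^ 2 + n 1 ^ 2 = 1 := by rw [← norm_sq_plane, n1]; norm_num
  rw [norm_sq_plane] at hu
  rw [inner_plane] at h0 h2 n2
  set u := b - a
  have hc : (m 0 * n 1 - m 1 * n 0) ^ 2 = 1 := by
    linear_combination (n 0 ^ 2 + n 1 ^ 2) * hm2 + hn2 - (m 0 * n 0 + m 1 * n 1) * h0
  have e0 : (m 0 * n 1 - m 1 * n 0) * u 0 = 0 := by linear_combination n 1 * h2 - m 1 * n2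
  have e1 : (m 0 * n 1 - m 1 * n 0) * u 1 = 0 := by linear_combination m 0 * n2 - n 0 * h2
  have hc0 : m 0 * n 1 - m 1 * n 0 ≠ 0 := fun h => by rw [h] at hc; norm_num at hc
  rw [(mul_eq_zero.1 e0).resolve_left hc0, (mul_eq_zero.1 e1).resolve_left hc0] at hu
  norm_num at hu

lemma exists_triangle_of_edge (T : Triangulation Ω) {e : Finset Plane} (he : e ∈ T.edges) :
    ∃ K ∈ T.triangles, e ∈ edgesOf K := by
  obtain ⟨hef, hec⟩ := T.mem_edges.1 he
  obtain ⟨K, hK, heK, hc⟩ := T.pure e hef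
  exact ⟨K, T.mem_triangles.2 ⟨hK, hc⟩, Finset.mem_powersetCard.2 ⟨heK, hec⟩⟩

lemma integrable_inner_of_memLp {α E : Type*} [MeasurableSpace α] {μ : Measure α}
    [NormedAddCommGroup E] [InnerProductSpace ℝ E] {f g : α → E} (hf : MemLp f 2 μ)
    (hg : MemLp g 2 μ) : Integrable (fun x => inner ℝ (f x) (g x)) μ := by
  refine (L2.integrable_inner (𝕜 := ℝ) (hf.toLp f) (hg.toLp g)).congr ?_
  filter_upwards [hf.coeFn_toLp, hg.coeFn_toLp] with x h1 h2
  rw [h1, h2]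

lemma polyGrad_zero (x : Plane) : polyGrad 0 x = 0 := by
  ext i; simp [polyGrad_apply, polyFun_zero]

/-- The first component of a function with vanishing weak Laplacian is zero. -/
lemma fst_eq_zero_of_weakLaplacian_eq_zero {T : Triangulation Ω} (hΩ : IsOpen Ω)
    {ν : Finset Plane → Plane} {k : ℕ} {v : L2 Ω × T.EdgeL2} (hv : v ∈ Vh T k)
    (h0 : ∀ K ∈ T.triangles, weakLaplacian T ν (k + 3) v K = 0) : v.1 = 0 := by
  obtain ⟨g, φ, hg, hφ, hφ0, hφ1⟩ := hv.1.1
  have hgp : ∀ K ∈ T.triangles, g =ᵐ[volume.restrict (hull K)] polyGrad (localPoly v.1 K) := by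
    intro K hK
    obtain ⟨p, -, hp⟩ := hv.1.2 K hK
    rw [localPoly_eq hK hp]
    exact weakGradient_eq_polyGrad hΩ hK hp hg hφ hφ0 hφ1
  -- The approximants of `v₀` serve as test functions: `∫ ∇φₙ · g` is zero for every `n` and tends
  -- to `∫ |g|²`.
  have hlim := tendsto_integral_inner (fun n => memLp_gradient (hφ n).1 (hφ n).2.1) hg hg hφ1
  have hz : ∀ n, ∫ x in Ω, inner ℝ (gradient (φ n) x) (g x) = 0 := by
    intro n
    have hint : Integrable (fun x => inner ℝ (gradient (φ n) x) (g x)) (volume.restrict Ω) :=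
      integrable_inner_of_memLp (memLp_gradient (hφ n).1 (hφ n).2.1) hg
    rw [setIntegral_eq_sum_triangles T hint, ← sum_integral_polyGrad_eq_zero hΩ hv h0
      ((hφ n).1.of_le (by simp)) (hφ n).2.2]
    refine Finset.sum_congr rfl fun K hK => integral_congr_ae ?_
    filter_upwards [hgp K hK] with x hx
    rw [hx, inner_gradient_eq]
  simp only [hz] at hlim
  have hgg : ∫ x in Ω, inner ℝ (g x) (g x) = 0 := (tendsto_nhds_unique hlim tendsto_const_nhds)
  have hg0 : g =ᵐ[volume.restrict Ω] 0 := by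
    have := (integral_eq_zero_iff_of_nonneg (fun x => real_inner_self_nonneg)
      (integrable_inner_of_memLp hg hg)).1 hgg
    filter_upwards [this] with x hx
    exact inner_self_eq_zero.1 hx
  exact eq_zero_of_weakGradient_eq_zero (isBounded_of_triangulation T) hg0 hφ hφ0 hφ1

lemma localPoly_zero {T : Triangulation Ω} {K : Finset Plane} (hK : K ∈ T.triangles) :
    localPoly ((0 : L2 Ω) : Plane → ℝ) K = 0 := by
  refine localPoly_eq hK ?_
  have h := ae_mono (restrict_hull_le T hK) (Lp.coeFn_zero ℝ 2 (volume.restrict Ω))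
  filter_upwards [h] with x hx
  rw [hx, polyFun_zero]
  rfl

/-- Once `v₀ = 0`, its normal derivatives `vₙ (nₑ · n)` vanish. Every edge is a side of some
triangle, where `nₑ · n ≠ 0`, so `vₙ = 0` as well. -/
lemma eq_zero_of_weakLaplacian_eq_zero {T : Triangulation Ω} (hΩ : IsOpen Ω)
    {ν : Finset Plane → Plane} (hν : IsNormalChoice T ν) {k : ℕ} {v : L2 Ω × T.EdgeL2}
    (hv : v ∈ Vh T k) (h0 : ∀ K ∈ T.triangles, weakLaplacian T ν (k + 3) v K = 0) : v = 0 := by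
  have hv1 := fst_eq_zero_of_weakLaplacian_eq_zero hΩ hv h0
  refine Prod.ext hv1 ?_
  rw [Prod.snd_zero, Lp.eq_zero_iff_ae_eq_zero]
  have : ∀ᵐ x ∂(μH[1] : Measure Plane).restrict (⋃ e ∈ T.edges, hull e), v.2 x = 0 := by
    rw [ae_restrict_biUnion_finset_iff]
    intro e he
    obtain ⟨K, hK, heK⟩ := exists_triangle_of_edge T he
    filter_upwards [(harmonic_of_weakLaplacian_eq_zero hK hv (h0 K hK)).2 e heK] with x hx
    rw [polyFun_polyDeriv, hv1, localPoly_zero hK, polyGrad_zero, inner_zero_left] at hx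
    exact (mul_eq_zero.1 hx).resolve_right (inner_outwardNormal_ne_zero hν hK heK)
  exact this

/-! ### Linear structure -/

/-- Combinations `c • u + v` are used throughout, since they cover sums (`c = 1`) and multiples (`v
= 0`) at once. -/
lemma tendsto_eLpNorm_comb {α E : Type*} [MeasurableSpace α] {μ : Measure α}
    [NormedAddCommGroup E] [NormedSpace ℝ E] {F G : ℕ → α → E} {f h : α → E}
    (hF : ∀ n, MemLp (F n) 2 μ) (hG : ∀ n, MemLp (G n) 2 μ) (hf : MemLp f 2 μ)
    (hh : MemLp h 2 μ) (c : ℝ)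
    (h1 : Tendsto (fun n => eLpNorm (fun x => F n x - f x) 2 μ) atTop (𝓝 0))
    (h2 : Tendsto (fun n => eLpNorm (fun x => G n x - h x) 2 μ) atTop (𝓝 0)) :
    Tendsto (fun n => eLpNorm (fun x => (c • F n x + G n x) - (c • f x + h x)) 2 μ)
      atTop (𝓝 0) :=
  (Lp.tendsto_Lp_iff_tendsto_eLpNorm'' (fun n => c • F n + G n)
    (fun n => ((hF n).const_smul c).add (hG n)) (c • f + h) ((hf.const_smul c).add hh)).1
    (((tendsto_toLp hF hf h1).const_smul c).add (tendsto_toLp hG hh h2))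

lemma gradient_comb {φ ψ : Plane → ℝ} (hφ : ContDiff ℝ ∞ φ) (hψ : ContDiff ℝ ∞ ψ) (c : ℝ)
    (x : Plane) : gradient (fun x => c • φ x + ψ x) x = c • gradient φ x + gradient ψ x := by
  have hne : (∞ : WithTop ℕ∞) ≠ 0 := by simp
  have h1 := hφ.differentiable hne x
  have h2 := hψ.differentiable hne x
  refine ext_inner_right ℝ fun w => ?_
  rw [inner_add_left, real_inner_smul_left, inner_gradient_eq, inner_gradient_eq,
    inner_gradient_eq, ((h1.hasFDerivAt.fun_const_smul c).fun_add h2.hasFDerivAt).fderiv]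
  rfl

lemma isH10_zero : IsH10 (0 : L2 Ω) := by
  refine ⟨0, 0, MemLp.zero, fun n => ⟨contDiff_const, HasCompactSupport.zero, ?_⟩, ?_, ?_⟩
  · simp [tsupport]
  · refine tendsto_const_nhds.congr fun n => ?_
    refine (eLpNorm_eq_zero_of_ae_zero ?_).symm
    filter_upwards [Lp.coeFn_zero ℝ 2 (volume.restrict Ω)] with x hx
    rw [hx]
    exact sub_self _
  · refine tendsto_const_nhds.congr fun n => ?_
    refine (eLpNorm_eq_zero_of_ae_zero (.of_forall fun x => ?_)).symm
    have : gradient ((0 : ℕ → Plane → ℝ) n) x = 0 := gradient_const x 0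
    rw [this]
    exact sub_self _

lemma IsH10.comb {u v : L2 Ω} (hu : IsH10 u) (hv : IsH10 v) (c : ℝ) : IsH10 (c • u + v) := by
  obtain ⟨g, φ, hg, hφ, h0, h1⟩ := hu
  obtain ⟨g', ψ, hg', hψ, h0', h1'⟩ := hv
  refine ⟨fun x => c • g x + g' x, fun n x => c • φ n x + ψ n x, (hg.const_smul c).add hg',
    fun n => ⟨((hφ n).1.const_smul c).add (hψ n).1,
      ((hφ n).2.1.smul_left (f := fun _ => c)).add (hψ n).2.1, ?_⟩, ?_, ?_⟩
  · refine (tsupport_add _ _).trans (Set.union_subset ?_ (hψ n).2.2)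
    exact (tsupport_smul_subset_right (fun _ => c) (φ n)).trans (hφ n).2.2
  · refine (tendsto_eLpNorm_comb (fun n => memLp_testFunction (hφ n).1 (hφ n).2.1)
      (fun n => memLp_testFunction (hψ n).1 (hψ n).2.1) (Lp.memLp u) (Lp.memLp v) c h0 h0').congr
      fun n => eLpNorm_congr_ae ?_
    filter_upwards [Lp.coeFn_add (c • u) v, Lp.coeFn_smul c u] with x e1 e2
    rw [e1, Pi.add_apply, e2, Pi.smul_apply]
  · refine (tendsto_eLpNorm_comb (fun n => memLp_gradient (hφ n).1 (hφ n).2.1)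
      (fun n => memLp_gradient (hψ n).1 (hψ n).2.1) hg hg' c h1 h1').congr fun n => ?_
    simp only [gradient_comb (hφ n).1 (hψ n).1]

lemma Represents.comb {T : Triangulation Ω} {K : Finset Plane} (hK : K ∈ T.triangles)
    {u v : L2 Ω} {p q : MvPolynomial (Fin 2) ℝ} (hp : Represents p u K) (hq : Represents q v K)
    (c : ℝ) : Represents (c • p + q) (c • u + v : L2 Ω) K := by
  have e1 := ae_mono (restrict_hull_le T hK) (Lp.coeFn_add (c • u) v)
  have e2 := ae_mono (restrict_hull_le T hK) (Lp.coeFn_smul c u)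
  filter_upwards [e1, e2, hp, hq] with x e1 e2 hp hq
  rw [e1, Pi.add_apply, e2, Pi.smul_apply, hp, hq, polyFun_add, polyFun_smul, smul_eq_mul]

lemma restrict_edge_le (T : Triangulation Ω) {e : Finset Plane} (he : e ∈ T.edges) :
    (μH[1] : Measure Plane).restrict (hull e) ≤ (μH[1] : Measure Plane).restrict T.skeleton :=
  Measure.restrict_mono (Set.subset_biUnion_of_mem (u := fun e => hull e) he) le_rfl

lemma edge_comb_ae (T : Triangulation Ω) {e : Finset Plane} (he : e ∈ T.edges) (u v : T.EdgeL2)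
    (c : ℝ) : ∀ᵐ x ∂(μH[1] : Measure Plane).restrict (hull e),
      (c • u + v : T.EdgeL2) x = c * u x + v x := by
  filter_upwards [ae_mono (restrict_edge_le T he) (Lp.coeFn_add (c • u) v),
    ae_mono (restrict_edge_le T he) (Lp.coeFn_smul c u)] with x e1 e2
  rw [e1, Pi.add_apply, e2, Pi.smul_apply, smul_eq_mul]

lemma zero_mem_Vh0 (T : Triangulation Ω) (k : ℕ) : (0 : L2 Ω × T.EdgeL2) ∈ Vh0 T k := by
  have hz : ∀ e ∈ T.edges, ((0 : T.EdgeL2) : Plane → ℝ) =ᵐ[(μH[1] : Measure Plane).restrict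
      (hull e)] 0 := fun e he => ae_mono (restrict_edge_le T he) (Lp.coeFn_zero _ _ _)
  refine ⟨⟨⟨isH10_zero, fun K hK => ⟨0, Submodule.zero_mem _, ?_⟩⟩,
    fun e he => ⟨0, Submodule.zero_mem _, ?_⟩⟩, fun e he _ => hz e he⟩
  · filter_upwards [ae_mono (restrict_hull_le T hK)
      (Lp.coeFn_zero ℝ 2 (volume.restrict Ω))] with x hx
    rw [Prod.fst_zero, hx, polyFun_zero]
    rfl
  · filter_upwards [hz e he] with x hx
    rw [Prod.snd_zero, hx, polyFun_zero]
    rfl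

lemma comb_mem_Vh0 {T : Triangulation Ω} {k : ℕ} {u v : L2 Ω × T.EdgeL2} (hu : u ∈ Vh0 T k)
    (hv : v ∈ Vh0 T k) (c : ℝ) : c • u + v ∈ Vh0 T k := by
  refine ⟨⟨⟨hu.1.1.1.comb hv.1.1.1 c, fun K hK => ?_⟩, fun e he => ?_⟩, fun e he hfr => ?_⟩
  · obtain ⟨p, hp, hpu⟩ := hu.1.1.2 K hK
    obtain ⟨q, hq, hqv⟩ := hv.1.1.2 K hK
    exact ⟨c • p + q, Submodule.add_mem _ (Submodule.smul_mem _ c hp) hq, hpu.comb hK hqv c⟩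
  · obtain ⟨p, hp, hpu⟩ := hu.1.2 e he
    obtain ⟨q, hq, hqv⟩ := hv.1.2 e he
    refine ⟨c • p + q, Submodule.add_mem _ (Submodule.smul_mem _ c hp) hq, ?_⟩
    filter_upwards [edge_comb_ae T he u.2 v.2 c, hpu, hqv] with x h h1 h2
    rw [Prod.snd_add, Prod.smul_snd, h, h1, h2, polyFun_add, polyFun_smul]
  · filter_upwards [edge_comb_ae T he u.2 v.2 c, hu.2 e he hfr, hv.2 e he hfr] with x h h1 h2
    rw [Prod.snd_add, Prod.smul_snd, h, h1, h2]
    simp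

/-- `V_h^0` as a linear space. -/
def Vh0Submodule (T : Triangulation Ω) (k : ℕ) : Submodule ℝ (L2 Ω × T.EdgeL2) where
  carrier := Vh0 T k
  zero_mem' := zero_mem_Vh0 T k
  add_mem' {u v} hu hv := by simpa using comb_mem_Vh0 hu hv 1
  smul_mem' c u hu := by simpa using comb_mem_Vh0 hu (zero_mem_Vh0 T k) c

/-- The weak Laplacian and the local polynomial are chosen by `Classical.epsilon`, so linearity
comes from uniqueness. Membership in `Vh` guarantees that the local polynomials exist, without which
the choice would be arbitrary. -/
lemma weakLaplacian_comb {T : Triangulation Ω} {k : ℕ} (ν : Finset Plane → Plane) (m : ℕ)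
    {u v : L2 Ω × T.EdgeL2} (hu : u ∈ Vh T k) (hv : v ∈ Vh T k) (c : ℝ) {K : Finset Plane}
    (hK : K ∈ T.triangles) :
    weakLaplacian T ν m (c • u + v) K =
      c • weakLaplacian T ν m u K + weakLaplacian T ν m v K := by
  refine (existsUnique_weakLaplacian hK ν m (c • u + v)).unique
    (isWeakLaplacian_weakLaplacian hK ν m _) ?_
  have hdu := isWeakLaplacian_weakLaplacian hK ν m u
  have hdv := isWeakLaplacian_weakLaplacian hK ν m v
  set d := weakLaplacian T ν m u K
  set d' := weakLaplacian T ν m v K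
  refine ⟨Submodule.add_mem _ (Submodule.smul_mem _ c hdu.1) hdv.1, fun φ hφ => ?_⟩
  have e1 : ∀ x, polyFun (c • d + d') x * polyFun φ x =
      c * (polyFun d x * polyFun φ x) + polyFun d' x * polyFun φ x := fun x => by
    rw [polyFun_add, polyFun_smul]; ring
  simp only [e1]
  rw [integral_add ((integrableOn_polyFun_mul d φ K).const_mul c)
    (integrableOn_polyFun_mul d' φ K), integral_const_mul, hdu.2 φ hφ, hdv.2 φ hφ]
  obtain ⟨p, hp, hpu⟩ := hu.1.2 K hK
  obtain ⟨q, hq, hqv⟩ := hv.1.2 K hK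
  have e2 : localPoly (c • u + v).1 K = c • p + q := localPoly_eq hK (hpu.comb hK hqv c)
  simp only [weakLaplacianRhs, e2, localPoly_eq hK hpu, localPoly_eq hK hqv]
  have e3 : ∀ x, gradDot (c • p + q) φ x = c * gradDot p φ x + gradDot q φ x := fun x => by
    simp only [gradDot, map_add, Derivation.map_smul, polyFun_add, polyFun_smul,
      Fin.sum_univ_two]
    ring
  simp only [e3]
  rw [integral_add ((integrableOn_gradDot p φ K).const_mul c) (integrableOn_gradDot q φ K),
    integral_const_mul]
  have e4 : ∀ e ∈ edgesOf K, ∫ x in hull e, (c • u + v).2 x *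
      inner ℝ (ν e) (outwardNormal K e) * polyFun φ x ∂(μH[1] : Measure Plane) =
      c * (∫ x in hull e, u.2 x * inner ℝ (ν e) (outwardNormal K e) * polyFun φ x
        ∂(μH[1] : Measure Plane)) + ∫ x in hull e, v.2 x *
      inner ℝ (ν e) (outwardNormal K e) * polyFun φ x ∂(μH[1] : Measure Plane) := by
    intro e he
    have he' := T.edgesOf_subset hK he
    rw [← integral_const_mul, ← integral_add ((integrableOn_edge he' _ _ _).const_mul c)
      (integrableOn_edge he' _ _ _)]
    refine integral_congr_ae ?_
    filter_upwards [edge_comb_ae T he' u.2 v.2 c] with x hx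
    rw [Prod.snd_add, Prod.smul_snd, hx]
    ring
  rw [Finset.sum_congr rfl e4, Finset.sum_add_distrib, ← Finset.mul_sum]
  ring

/-- The weak Laplacian as a linear map. -/
noncomputable def weakLaplacianMap (T : Triangulation Ω) (ν : Finset Plane → Plane) (k : ℕ) :
    Vh0Submodule T k →ₗ[ℝ] (T.triangles → Poly (k + 3)) where
  toFun v K := ⟨weakLaplacian T ν (k + 3) v K, (isWeakLaplacian_weakLaplacian K.2 ν _ _).1⟩
  map_add' u v := by
    ext1 K
    have := weakLaplacian_comb ν (k + 3) u.2.1 v.2.1 1 K.2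
    simp only [one_smul] at this
    exact Subtype.ext this
  map_smul' c u := by
    ext1 K
    have h := weakLaplacian_comb ν (k + 3) u.2.1 (zero_mem_Vh0 T k).1 c K.2
    -- Additivity at `0 + 0` shows that the weak Laplacian of zero is zero.
    have h0 := weakLaplacian_comb ν (k + 3) (zero_mem_Vh0 T k).1 (zero_mem_Vh0 T k).1 1 K.2
    simp only [one_smul, add_zero, left_eq_add] at h h0
    rw [h0, add_zero] at h
    exact Subtype.ext h

lemma weakLaplacianMap_injective {T : Triangulation Ω} (hΩ : IsOpen Ω)
    {ν : Finset Plane → Plane} (hν : IsNormalChoice T ν) (k : ℕ) :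
    Function.Injective (weakLaplacianMap T ν k) := by
  rw [injective_iff_map_eq_zero]
  intro v hv
  exact Subtype.ext (eq_zero_of_weakLaplacian_eq_zero hΩ hν v.2.1 fun K hK =>
    congrArg Subtype.val (congrFun hv ⟨K, hK⟩))

/-- The broken `L²` inner product. -/
noncomputable def brokenInner (T : Triangulation Ω) (m : ℕ) :
    (T.triangles → Poly m) →ₗ[ℝ] (T.triangles → Poly m) →ₗ[ℝ] ℝ :=
  LinearMap.mk₂ ℝ
    (fun p q => ∑ K : T.triangles, ∫ x in hull (K : Finset Plane),
      polyFun (p K) x * polyFun (q K) x)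
    (fun p p' q => by
      rw [← Finset.sum_add_distrib]
      refine Finset.sum_congr rfl fun K _ => ?_
      rw [← integral_add (integrableOn_polyFun_mul _ _ _) (integrableOn_polyFun_mul _ _ _)]
      simp only [Pi.add_apply, Submodule.coe_add, polyFun_add, add_mul])
    (fun c p q => by
      rw [smul_eq_mul, Finset.mul_sum]
      refine Finset.sum_congr rfl fun K _ => ?_
      rw [← integral_const_mul]
      simp only [Pi.smul_apply, Submodule.coe_smul, polyFun_smul, mul_assoc])
    (fun p q q' => by
      rw [← Finset.sum_add_distrib]
      refine Finset.sum_congr rfl fun K _ => ?_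
      rw [← integral_add (integrableOn_polyFun_mul _ _ _) (integrableOn_polyFun_mul _ _ _)]
      simp only [Pi.add_apply, Submodule.coe_add, polyFun_add, mul_add])
    (fun c p q => by
      rw [smul_eq_mul, Finset.mul_sum]
      refine Finset.sum_congr rfl fun K _ => ?_
      rw [← integral_const_mul]
      simp only [Pi.smul_apply, Submodule.coe_smul, polyFun_smul, mul_left_comm _ c])

lemma eq_zero_of_brokenInner_self {T : Triangulation Ω} {m : ℕ} {p : T.triangles → Poly m}
    (h : brokenInner T m p p = 0) : p = 0 := by
  funext K
  have h1 := (Finset.sum_eq_zero_iff_of_nonneg fun K _ =>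
    integral_nonneg fun x => mul_self_nonneg (polyFun (p K) x)).1 h K (Finset.mem_univ K)
  exact Subtype.ext (eq_zero_of_integral_sq (T.interior_nonempty K.2) h1)

lemma brokenInner_weakLaplacianMap (T : Triangulation Ω) (ν : Finset Plane → Plane) (k : ℕ)
    (u v : Vh0Submodule T k) :
    brokenInner T (k + 3) (weakLaplacianMap T ν k u) (weakLaplacianMap T ν k v) =
      Ah T ν k u v :=
  Finset.sum_coe_sort T.triangles fun K => ∫ x in hull K,
    polyFun (weakLaplacian T ν (k + 3) u K) x * polyFun (weakLaplacian T ν (k + 3) v K) x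

/-- The right-hand side of the scheme as a linear functional. -/
noncomputable def loadFunctional (T : Triangulation Ω) (k : ℕ) {f : Plane → ℝ}
    (hf : MemLp f 2 (volume.restrict Ω)) : Module.Dual ℝ (Vh0Submodule T k) where
  toFun v := ∫ x in Ω, f x * (v : L2 Ω × T.EdgeL2).1 x
  map_add' u v := by
    have hint : ∀ w : L2 Ω, Integrable (fun x => f x * w x) (volume.restrict Ω) := fun w =>
      hf.integrable_mul (Lp.memLp w)
    rw [← integral_add (hint _) (hint _)]
    refine integral_congr_ae ?_
    filter_upwards [Lp.coeFn_add (u : L2 Ω × T.EdgeL2).1 (v : L2 Ω × T.EdgeL2).1] with x hx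
    rw [Submodule.coe_add, Prod.fst_add, hx, Pi.add_apply, mul_add]
  map_smul' c u := by
    rw [RingHom.id_apply, smul_eq_mul, ← integral_const_mul]
    refine integral_congr_ae ?_
    filter_upwards [Lp.coeFn_smul c (u : L2 Ω × T.EdgeL2).1] with x hx
    rw [Submodule.coe_smul, Prod.smul_fst, hx, Pi.smul_apply, smul_eq_mul, mul_left_comm]

end SFC0WG

/-! ### Existence and uniqueness of the discrete solution -/

open SFC0WG in
theorem lemma3p3 (Ω : Set Plane) (hΩ_open : IsOpen Ω) (hΩ_conn : IsConnected Ω)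
    (T : Triangulation Ω) (ν : Finset Plane → Plane) (hν : IsNormalChoice T ν) (k : ℕ)
    (f : Plane → ℝ) (hf : MemLp f 2 (volume.restrict Ω)) :
    ∃! u : L2 Ω × T.EdgeL2, IsSolution T ν k f u := by
  have hD := weakLaplacianMap_injective hΩ_open hν k
  -- Finite dimension is inherited from the polynomial spaces through the injective weak Laplacian.
  have hfin : FiniteDimensional ℝ (Vh0Submodule T k) :=
    FiniteDimensional.of_injective (weakLaplacianMap T ν k) hD
  set B : Vh0Submodule T k →ₗ[ℝ] Module.Dual ℝ (Vh0Submodule T k) :=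
    (brokenInner T (k + 3)).compl₁₂ (weakLaplacianMap T ν k) (weakLaplacianMap T ν k) with hB
  have hBA : ∀ u v, B u v = Ah T ν k u v := brokenInner_weakLaplacianMap T ν k
  have hinj : Function.Injective B := by
    rw [injective_iff_map_eq_zero]
    intro u hu
    exact hD ((eq_zero_of_brokenInner_self (LinearMap.congr_fun hu u)).trans (map_zero _).symm)
  -- A space and its dual have equal finite dimension, so uniqueness implies existence.
  have hsurj : Function.Surjective B :=
    (LinearMap.injective_iff_surjective_of_finrank_eq_finrank
      (Subspace.dual_finrank_eq (K := ℝ) (V := Vh0Submodule T k)).symm).1 hinj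
  obtain ⟨u, hu⟩ := hsurj (loadFunctional T k hf)
  refine ⟨u, ⟨u.2, fun v hv => ?_⟩, fun u' hu' => ?_⟩
  · rw [← hBA u ⟨v, hv⟩, hu]
    rfl
  · have : (⟨u', hu'.1⟩ : Vh0Submodule T k) = u := hinj <| LinearMap.ext fun v => by
      rw [hu, hBA]
      exact hu'.2 v v.2
    exact congrArg Subtype.val this
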